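/- For a finitely supported mask $a:\mathbb{Z}^2\to\mathbb{R}$ with symbol $a(z)=\sum_{\alpha}a(\alpha)z^\alpha$, let $(S_af)(\alpha)=\sum_{\beta\in\mathbb{Z}^2}a(\alpha-2\beta)f(\beta)$ be the subdivision operator, and let $\mathrm{Esupp}(a)\subset\mathbb{R}^2$ be the closed convex hull of $\{\alpha\in\mathbb{Z}^2: a(\alpha)\neq0\}$. Let $e^{[1]}=(1,0)$, $e^{[2]}=(0,1)$, $e^{[3]}=(1,1)$. For $m\ge1$ let $s_m=s_m(e^{[1]},e^{[2]},e^{[3]})$ be the three-directional box-spline mask with symbol $$4\left(\frac{1+z_1}{2}\cdot\frac{1+z_2}{2}\cdot\frac{1+z_1z_2}{2}\right)^m,$$ and write $s=s_1$. Let $r\ge 1$ be an integer and put $$a_{mr}=a_{mr+1}=\cdots=a_{(m+1)r-1}=s_{m+1},\qquad m=0,1,2,\dots$$ Then the non-stationary subdivision scheme $(S_{a_k})_{k\ge0}$ converges: for every bounded $f:\mathbb{Z}^2\to\mathbb{R}$ there is a continuous $g:\mathbb{R}^2\to\mathbb{R}$, nonzero for at least one nonzero $f$, with $$\lim_{k\to\infty}\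 \sup_{\alpha\in\mathbb{Z}^2}\bigl|g(2^{-(k+1)}\alpha)-(S_{a_k}S_{a_{k-1}}\cdots S_{a_0}f)(\alpha)\bigr|=0 .$$ Moreover, the basic limit function $\phi_{0,r}$, i.e. the unique continuous limit $g$ for the initial data $f=\delta$ (where $\delta(0)=1$ and $\delta(\alpha)=0$ for $\alpha\ne0$), is $C^\infty$, and its support (the closure of the set where it does not vanish) is $$\mathrm{supp}(\phi_{0,r})=\left(1+\frac{1}{2^r-1}\right)\mathrm{Esupp}\bigl(s(e^{[1]},e^{[2]},e^{[3]})\bigr).$$ -/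

import Mathlib

open Filter Topology
open scoped Pointwise ContDiff

namespace Subdivision

noncomputable section

/-- The lattice `ℤ^d`. -/
abbrev Lattice (d : ℕ) := Fin d → ℤ

/-- Real sequences indexed by `ℤ^d`. -/
abbrev Seq (d : ℕ) := Lattice d → ℝ

/-- A finitely supported real mask `a` on `ℤ^d`, identified with its symbol
`a(z) = ∑ α, a(α) z^α`, a Laurent polynomial in `d` variables. The entry `a(α)` is `a.coeff α`,
and the monomial `z^α` is `AddMonoidAlgebra.single α 1`. -/
abbrev Mask (d : ℕ) := AddMonoidAlgebra ℝ (Lattice d)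

/-- A lattice point regarded as a point of Euclidean space. -/
def toEuclid {d : ℕ} (α : Lattice d) : EuclideanSpace ℝ (Fin d) :=
  WithLp.toLp 2 fun i => (α i : ℝ)

/-- The extended support of a mask: the closed convex hull of its support. -/
def Esupp {d : ℕ} (a : Mask d) : Set (EuclideanSpace ℝ (Fin d)) :=
  closure (convexHull ℝ (toEuclid '' {α : Lattice d | a.coeff α ≠ 0}))

/-- The subdivision operator `(S_a f)(α) = ∑ β, a(α - 2β) f(β)`. For each `α` only finitely many
terms are nonzero. -/
def subdivOp {d : ℕ} (a : Mask d) (f : Seq d) : Seq d :=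
  fun α => ∑ᶠ β : Lattice d, a.coeff (α - 2 • β) * f β

/-- The refined data `S_{a_{k-1}} ⋯ S_{a_0} f` after `k` steps of the non-stationary scheme with
masks `a_0, a_1, …`. -/
def refine {d : ℕ} (a : ℕ → Mask d) (f : Seq d) : ℕ → Seq d
  | 0 => f
  | k + 1 => subdivOp (a k) (refine a f k)

/-- The supremum norm `sup_α |f α|`, with values in `[0, ∞]`. -/
def supNorm {d : ℕ} (f : Seq d) : ENNReal := ⨆ α, ‖f α‖ₑ

/-- `g` is the limit of the scheme with masks `a_0, a_1, …` from the initial data `f`: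
`‖ g(2^{-(k+1)} ·) - S_{a_k} ⋯ S_{a_0} f ‖_∞ → 0` as `k → ∞`. -/
def IsLimit {d : ℕ} (a : ℕ → Mask d) (f : Seq d) (g : EuclideanSpace ℝ (Fin d) → ℝ) : Prop :=
  Tendsto (fun k : ℕ => supNorm fun α =>
    g (((2 : ℝ) ^ (k + 1))⁻¹ • toEuclid α) - refine a f (k + 1) α) atTop (𝓝 0)

/-- The scheme with masks `a_0, a_1, …` converges to `C^s` limit functions: every bounded initial
sequence has a `C^s` limit, and some nonzero bounded initial sequence has a nonzero one. -/
def Converges {d : ℕ} (a : ℕ → Mask d) (s : ℕ) : Prop :=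
  (∀ f : Seq d, supNorm f < ⊤ →
    ∃ g : EuclideanSpace ℝ (Fin d) → ℝ, ContDiff ℝ s g ∧ IsLimit a f g) ∧
  ∃ f : Seq d, f ≠ 0 ∧ supNorm f < ⊤ ∧
    ∃ g : EuclideanSpace ℝ (Fin d) → ℝ, g ≠ 0 ∧ ContDiff ℝ s g ∧ IsLimit a f g

/-- The sequence `δ` with `δ(0) = 1` and `δ(α) = 0` for `α ≠ 0`. -/
def delta (d : ℕ) : Seq d := Pi.single 0 1

/-- The box-spline mask of a finite collection `D` of directions (with repetitions), with symbol
`2^d ∏_{v ∈ D} (1 + z^v) / 2`. -/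
def boxMask {d : ℕ} (D : Multiset (Lattice d)) : Mask d :=
  (2 : ℝ) ^ d • (D.map fun v => (1 / 2 : ℝ) • (1 + AddMonoidAlgebra.single v 1)).prod

/-- The three-directional box-spline mask `s_m(e₁, e₂, e₃)`, with `e₁ = (1,0)`, `e₂ = (0,1)`,
`e₃ = (1,1)`, each repeated `m` times. -/
def threeDirMask (m : ℕ) : Mask 2 :=
  boxMask (m • ({![1, 0], ![0, 1], ![1, 1]} : Multiset (Lattice 2)))

/-- The mask sequence `a_{mr} = a_{mr+1} = ⋯ = a_{(m+1)r-1} = s_{m+1}(e₁, e₂, e₃)`, `m ≥ 0`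
(for `r ≥ 1`); here `k / r` is the integer part of the quotient. -/
def repeatedMasks (r k : ℕ) : Mask 2 := threeDirMask (k / r + 1)

theorem repeatedMasks_apply {r m j : ℕ} (hj : j < r) :
    repeatedMasks r (m * r + j) = threeDirMask (m + 1) := by
  have hr : 0 < r := by omega
  have h : (m * r + j) / r = m := by
    rw [Nat.add_comm, Nat.add_mul_div_right _ _ hr, Nat.div_eq_of_lt hj, Nat.zero_add]
  rw [repeatedMasks, h]

end

end Subdivision

/-! All masks are products over the three directions, so everything reduces to one variable. After
`n` steps the symbol is `4 ^ n` times the product, along the three directions, of one univariate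
symbol `uniSymbol r n`, in which the factor `(1 + z ^ (2 ^ (n - 1 - k))) / 2` has multiplicity `k /
r + 1`. Removing one factor from each level splits off `(1 + z + ⋯ + z ^ (2 ^ (n + r) - 1)) / 2 ^ (n
+ r)` and leaves the symbol of `r` steps earlier (`uniSymbol_add`). In the scaling limit this is the
self-similarity `X = U + X' / c`, with `c = 2 ^ r`, `U` uniform on `[0, 1]` and `X'` an independent
copy of `X`. Thus the limit density `p` satisfies `p x = ∫ u in (c x - c)..(c x), p u` and lives on
`[0, L]` with `L = 1 + L / c`.

Uniform convergence to `p` is obtained after two integrations. The averaging operator gains no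
factor on densities, but it contracts by `1 / c` on bounded perturbations of `x₊`. Its fixed point
`K` is smooth, because `K'` is a difference of dilates of `K`; the discrete second antiderivative
`rampSum` approximates `K` with error `O(n / 2 ^ n)`. Both `p` and its discrete counterpart are
finite second differences, at matching nodes, of these antiderivatives, so no derivative has to be
estimated (`density_tendsto`).

The bivariate limit is `φ x = ∫ t, p t * p (x 0 - t) * p (x 1 - t)`, a limit of Riemann sums.
Self-similarity forces `p > 0` on `(0, L)`, so `φ ≠ 0` exactly on the image of the open cube `(0,
L)³` under `(t, a, b) ↦ (a + t, b + t)`. The closure of this image is `L` times the zonotope of the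
three directions, which is the extended support of `s`. General bounded data follow by superposing
integer translates of `φ`. -/

namespace Subdivision

noncomputable section

/-! ### Symbols acting by convolution, and upsampling. -/

section Algebra

variable {G H : Type*} [AddCommGroup G] [AddCommGroup H]

/-- Translation of a function by `g`, as a homomorphism into linear endomorphisms. -/
def translation (G : Type*) [AddCommGroup G] : Multiplicative G →* Module.End ℝ (G → ℝ) where
  toFun g := LinearMap.funLeft ℝ ℝ fun α => α - g.toAdd
  map_one' := by ext; simp [LinearMap.funLeft_apply]
  map_mul' g h := by
    ext f α
    simp only [LinearMap.funLeft_apply, Module.End.mul_apply, toAdd_mul]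
    congr 1; abel

/-- The action of the group algebra on functions by convolution. -/
def act (G : Type*) [AddCommGroup G] : AddMonoidAlgebra ℝ G →ₐ[ℝ] Module.End ℝ (G → ℝ) :=
  AddMonoidAlgebra.lift ℝ _ G (translation G)

theorem act_apply (a : AddMonoidAlgebra ℝ G) (f : G → ℝ) (α : G) :
    act G a f α = a.coeff.sum fun g c => c * f (α - g) := by
  rw [act, AddMonoidAlgebra.lift_apply, Finsupp.sum, Finsupp.sum, LinearMap.sum_apply,
    Finset.sum_apply]
  rfl

@[simp]
theorem act_single (g : G) (c : ℝ) (f : G → ℝ) (α : G) :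
    act G (AddMonoidAlgebra.single g c) f α = c * f (α - g) := by
  rw [act_apply]; simp

theorem act_mul (a b : AddMonoidAlgebra ℝ G) (f : G → ℝ) : act G (a * b) f = act G a (act G b f) := by
  rw [map_mul]; rfl

theorem act_add (a b : AddMonoidAlgebra ℝ G) (f : G → ℝ) : act G (a + b) f = act G a f + act G b f := by
  rw [map_add]; rfl

theorem act_smul (c : ℝ) (a : AddMonoidAlgebra ℝ G) (f : G → ℝ) : act G (c • a) f = c • act G a f := by
  rw [map_smul]; rfl

theorem act_sum {ι : Type*} (s : Finset ι) (a : ι → AddMonoidAlgebra ℝ G) (f : G → ℝ) :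
    act G (∑ i ∈ s, a i) f = ∑ i ∈ s, act G (a i) f := by
  rw [map_sum, LinearMap.sum_apply]

theorem act_pi_single [DecidableEq G] (a : AddMonoidAlgebra ℝ G) (α : G) :
    act G a (Pi.single 0 1) α = a.coeff α := by
  rw [act_apply, Finsupp.sum, Finset.sum_eq_single α]
  · simp
  · intro β _ h
    simp [sub_eq_zero, h.symm]
  · intro h
    simpa using h

theorem act_map (ι : H →+ G) (a : AddMonoidAlgebra ℝ H) (f : G → ℝ) (α : G) :
    act G (AddMonoidAlgebra.mapDomainRingHom ℝ ι a) f α =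
      a.coeff.sum fun h c => c * f (α - ι h) := by
  rw [act_apply]
  change Finsupp.sum (Finsupp.mapDomain ι a.coeff) _ = _
  rw [Finsupp.sum_mapDomain_index]
  · simp
  · intros; ring

/-- Insertion of zeros: the function supported on `N • G` with value `f β` at `N • β`. -/
def upsample (N : ℕ) (f : G → ℝ) : G → ℝ := Function.extend (fun β : G => N • β) f 0

/-- The substitution `z ↦ z ^ N` in symbols. -/
def dilate (G : Type*) [AddCommGroup G] (N : ℕ) : AddMonoidAlgebra ℝ G →+* AddMonoidAlgebra ℝ G :=
  AddMonoidAlgebra.mapDomainRingHom ℝ (nsmulAddMonoidHom N : G →+ G)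

theorem dilate_single (N : ℕ) (g : G) (c : ℝ) :
    dilate G N (AddMonoidAlgebra.single g c) = AddMonoidAlgebra.single (N • g) c := by
  simp [dilate]

theorem nsmul_inj [IsAddTorsionFree G] {N : ℕ} (hN : N ≠ 0) :
    Function.Injective (fun β : G => N • β) := nsmul_right_injective hN

theorem upsample_nsmul [IsAddTorsionFree G] {N : ℕ} (hN : N ≠ 0) (f : G → ℝ) (β : G) :
    upsample N f (N • β) = f β := (nsmul_inj hN).extend_apply f (0 : G → ℝ) β

theorem upsample_of_notMem (N : ℕ) (f : G → ℝ) {α : G} (h : ¬ ∃ β : G, N • β = α) :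
    upsample N f α = 0 := Function.extend_apply' f (0 : G → ℝ) α h

theorem upsample_one (f : G → ℝ) [IsAddTorsionFree G] : upsample 1 f = f := by
  ext α
  simpa using upsample_nsmul one_ne_zero f α

theorem upsample_upsample [IsAddTorsionFree G] {M N : ℕ} (hM : M ≠ 0) (hN : N ≠ 0) (f : G → ℝ) :
    upsample M (upsample N f) = upsample (N * M) f := by
  ext α
  by_cases h : ∃ β : G, M • β = α
  · obtain ⟨β, rfl⟩ := h
    rw [upsample_nsmul hM]
    by_cases h' : ∃ γ : G, N • γ = β
    · obtain ⟨γ, rfl⟩ := h'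
      rw [upsample_nsmul hN, ← mul_nsmul, upsample_nsmul (mul_ne_zero hN hM)]
    · rw [upsample_of_notMem _ _ h', upsample_of_notMem]
      rintro ⟨γ, hγ⟩
      exact h' ⟨γ, nsmul_inj hM (by simpa [mul_nsmul] using hγ)⟩
  · rw [upsample_of_notMem _ _ h, upsample_of_notMem]
    rintro ⟨γ, hγ⟩
    exact h ⟨N • γ, by rw [← mul_nsmul, hγ]⟩

theorem upsample_add [IsAddTorsionFree G] {N : ℕ} (hN : N ≠ 0) (f g : G → ℝ) :
    upsample N (f + g) = upsample N f + upsample N g := by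
  ext α
  by_cases h : ∃ β : G, N • β = α
  · obtain ⟨β, rfl⟩ := h
    simp [upsample_nsmul hN]
  · simp [upsample_of_notMem _ _ h]

/-- This commutation moves every upsampling to the right of every convolution, so that a product of
subdivision operators becomes a single convolution after a single upsampling. -/
theorem upsample_act [IsAddTorsionFree G] {N : ℕ} (hN : N ≠ 0) (a : AddMonoidAlgebra ℝ G)
    (f : G → ℝ) : upsample N (act G a f) = act G (dilate G N a) (upsample N f) := by
  classical
  induction a using AddMonoidAlgebra.induction_linear with
  | zero =>
    ext α
    by_cases h : ∃ β : G, N • β = α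
    · obtain ⟨β, rfl⟩ := h
      simp [upsample_nsmul hN]
    · simp [upsample_of_notMem _ _ h]
  | add a b ha hb => rw [act_add, upsample_add hN, ha, hb, map_add, act_add]
  | single g c =>
    rw [dilate_single]
    ext α
    by_cases h : ∃ β : G, N • β = α
    · obtain ⟨β, rfl⟩ := h
      rw [upsample_nsmul hN, act_single, act_single, ← nsmul_sub, upsample_nsmul hN]
    · rw [upsample_of_notMem _ _ h, act_single, upsample_of_notMem, mul_zero]
      rintro ⟨β, hβ⟩
      exact h ⟨β + g, by rw [nsmul_add, hβ, sub_add_cancel]⟩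

theorem finsum_coeff_mul [IsAddTorsionFree G] {N : ℕ} (hN : N ≠ 0) (a : AddMonoidAlgebra ℝ G)
    (f : G → ℝ) (α : G) :
    ∑ᶠ β : G, a.coeff (α - N • β) * f β = act G a (upsample N f) α := by
  calc ∑ᶠ β : G, a.coeff (α - N • β) * f β
      = ∑ᶠ β : G, a.coeff (α - N • β) * upsample N f (N • β) := by simp only [upsample_nsmul hN]
    _ = ∑ᶠ γ ∈ Set.range (fun β : G => N • β), a.coeff (α - γ) * upsample N f γ :=
        (finsum_mem_range (f := fun γ => a.coeff (α - γ) * upsample N f γ) (nsmul_inj hN)).symm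
    _ = ∑ᶠ γ, a.coeff (α - γ) * upsample N f γ := by
        refine finsum_congr fun γ => ?_
        by_cases h : γ ∈ Set.range (fun β : G => N • β)
        · simp [h]
        · rw [upsample_of_notMem N f h]; simp
    _ = ∑ᶠ γ, a.coeff γ * upsample N f (α - γ) := by
        rw [← finsum_comp_equiv (Equiv.subLeft α)]
        simp
    _ = act G a (upsample N f) α := by
        rw [act_apply, Finsupp.sum]
        refine finsum_eq_sum_of_support_subset _ fun γ hγ => ?_
        simp only [Function.mem_support] at hγ
        simpa using left_ne_zero_of_mul hγ

end Algebra

theorem subdivOp_eq_act {d : ℕ} (a : Mask d) (f : Seq d) :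
    subdivOp a f = act _ a (upsample 2 f) :=
  funext fun α => finsum_coeff_mul two_ne_zero a f α

/-- The symbol of the product of the first `n` subdivision operators. -/
def iterMask {d : ℕ} (a : ℕ → Mask d) : ℕ → Mask d
  | 0 => 1
  | n + 1 => a n * dilate _ 2 (iterMask a n)

theorem refine_eq_act {d : ℕ} (a : ℕ → Mask d) (f : Seq d) (n : ℕ) :
    refine a f n = act _ (iterMask a n) (upsample (2 ^ n) f) := by
  induction n with
  | zero => simp [refine, iterMask, upsample_one]
  | succ n ih =>
    rw [refine, ih, subdivOp_eq_act, upsample_act two_ne_zero, iterMask, act_mul,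
      upsample_upsample two_ne_zero (by positivity), pow_succ]

theorem refine_eq_finsum {d : ℕ} (a : ℕ → Mask d) (f : Seq d) (n : ℕ) (α : Lattice d) :
    refine a f n α = ∑ᶠ β, (iterMask a n).coeff (α - 2 ^ n • β) * f β := by
  rw [refine_eq_act, finsum_coeff_mul (by positivity)]

theorem refine_delta {d : ℕ} (a : ℕ → Mask d) (n : ℕ) (α : Lattice d) :
    refine a (delta d) n α = (iterMask a n).coeff α := by
  rw [refine_eq_finsum, finsum_eq_single _ 0]
  · simp [delta]
  · intro β hβ
    simp [delta, hβ]

/-! ### The univariate symbols and their self-similarity. -/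

section OneDim

/-- The univariate averaging symbol `(1 + z) / 2`. -/
def halfMask : AddMonoidAlgebra ℝ ℤ := (1 / 2 : ℝ) • (1 + AddMonoidAlgebra.single 1 1)

/-- The symbols of the normalised univariate scheme with masks `((1 + z) / 2) ^ (n / r + 1)`. -/
def uniSymbol (r : ℕ) : ℕ → AddMonoidAlgebra ℝ ℤ
  | 0 => 1
  | n + 1 => halfMask ^ (n / r + 1) * dilate ℤ 2 (uniSymbol r n)

/-- The symbol `(1 + z + ⋯ + z ^ (N - 1)) / N`. -/
def boxSymbol (N : ℕ) : AddMonoidAlgebra ℝ ℤ :=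
  (N : ℝ)⁻¹ • ∑ i ∈ Finset.range N, AddMonoidAlgebra.single (i : ℤ) 1

theorem dilate_smul {G : Type*} [AddCommGroup G] (N : ℕ) (c : ℝ) (a : AddMonoidAlgebra ℝ G) :
    dilate G N (c • a) = c • dilate G N a := by
  induction a using AddMonoidAlgebra.induction_linear with
  | zero => simp
  | add a b ha hb => simp [smul_add, ha, hb]
  | single g b => simp [dilate_single]

theorem halfMask_mul_dilate_boxSymbol (N : ℕ) :
    halfMask * dilate ℤ 2 (boxSymbol N) = boxSymbol (2 * N) := by
  have key : (1 + AddMonoidAlgebra.single 1 1) *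
      (∑ i ∈ Finset.range N, AddMonoidAlgebra.single (2 * (i : ℤ)) (1 : ℝ)) =
      ∑ i ∈ Finset.range (2 * N), AddMonoidAlgebra.single (i : ℤ) 1 := by
    induction N with
    | zero => simp
    | succ N ih =>
      rw [Finset.sum_range_succ, mul_add, ih, show 2 * (N + 1) = 2 * N + 1 + 1 by ring,
        Finset.sum_range_succ, Finset.sum_range_succ, add_mul, one_mul,
        AddMonoidAlgebra.single_mul_single]
      push_cast
      rw [add_comm (1 : ℤ), one_mul, add_assoc]
  rw [boxSymbol, dilate_smul, map_sum, halfMask, boxSymbol, ← key]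
  simp only [dilate_single, smul_mul_smul_comm]
  push_cast
  rw [mul_inv]
  norm_num

/-- For the first `r` steps every exponent is `1`, and the product of the `(1 + z ^ (2 ^ j)) / 2` is
a geometric sum by binary expansion. -/
theorem uniSymbol_eq_boxSymbol {r n : ℕ} (hn : n ≤ r) : uniSymbol r n = boxSymbol (2 ^ n) := by
  induction n with
  | zero =>
    rw [uniSymbol, boxSymbol, AddMonoidAlgebra.one_def]
    simp only [pow_zero, Finset.range_one, Finset.sum_singleton, Nat.cast_one, inv_one, one_smul,
      Nat.cast_zero]
  | succ n ih =>
    rw [uniSymbol, ih (by omega), Nat.div_eq_of_lt (by omega), zero_add, pow_one,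
      halfMask_mul_dilate_boxSymbol, pow_succ']

/-- One factor from each level forms the box symbol. What remains has exponent `k / r` at level `k`:
nothing for `k < r`, and the original exponents shifted by `r` afterwards. -/
theorem uniSymbol_add {r : ℕ} (hr : 1 ≤ r) (n : ℕ) :
    uniSymbol r (n + r) = boxSymbol (2 ^ (n + r)) * uniSymbol r n := by
  induction n with
  | zero => rw [zero_add, uniSymbol_eq_boxSymbol le_rfl, uniSymbol, mul_one]
  | succ n ih =>
    rw [show n + 1 + r = n + r + 1 by ring, uniSymbol, ih, uniSymbol,
      Nat.add_div_right n (by omega : 0 < r), pow_succ halfMask (n / r + 1), map_mul, pow_succ' 2,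
      ← halfMask_mul_dilate_boxSymbol]
    ring

end OneDim

/-! ### The limit density, constructed through its second antiderivative. -/

section Profile

open intervalIntegral

/-- A continuous function at bounded distance from `x₊` that is invariant under the averaging
operator of ratio `c`. Its second derivative is the density of `∑ c⁻ᵐ Uₘ` with independent
uniform `Uₘ`. -/
structure IsProfile (c : ℝ) (K : ℝ → ℝ) : Prop where
  continuous : Continuous K
  bounded : ∃ B, ∀ x, |K x - max x 0| ≤ B
  invariant : ∀ x, K x = (c ^ 2)⁻¹ * ∫ u in (c * x - c)..(c * x), K u

theorem abs_max_sub_max_le {s x : ℝ} (h0 : 0 ≤ s) (h1 : s ≤ 1) :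
    |max (x - s) 0 - max x 0| ≤ 1 := by
  refine (abs_max_sub_max_le_abs _ _ _).trans ?_
  rw [sub_sub_cancel_left, abs_neg, abs_of_nonneg h0]
  exact h1

open BoundedContinuousFunction in
/-- The averaging operator in terms of the deviation from `x₊`. -/
def profileMap (c : ℝ) (b : ℝ →ᵇ ℝ) : ℝ →ᵇ ℝ :=
  BoundedContinuousFunction.ofNormedAddCommGroup
    (fun x => ∫ s in (0 : ℝ)..1, (max (x - s) 0 - max x 0 + c⁻¹ * b (c * (x - s))))
    (by
      apply continuous_parametric_intervalIntegral_of_continuous'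
      fun_prop)
    (1 + |c⁻¹| * ‖b‖)
    (by
      intro x
      refine (norm_integral_le_of_norm_le_const (C := 1 + |c⁻¹| * ‖b‖) ?_).trans (by simp)
      intro s hs
      rw [Set.uIoc_of_le zero_le_one] at hs
      refine (norm_add_le _ _).trans (add_le_add (abs_max_sub_max_le hs.1.le hs.2) ?_)
      rw [norm_mul, Real.norm_eq_abs]
      gcongr
      exact b.norm_coe_le_norm _)

/-- The terms in `x₊` cancel in a difference of two values; the factor `c⁻¹` in front of `b`
remains. -/
theorem profileMap_contracting {c : ℝ} (hc : 1 < c) :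
    ContractingWith (Real.toNNReal c⁻¹) (profileMap c) := by
  have hc0 : 0 < c := by linarith
  refine ⟨by rw [Real.toNNReal_lt_one]; exact inv_lt_one_of_one_lt₀ hc, ?_⟩
  refine LipschitzWith.of_dist_le_mul fun b b' => ?_
  rw [Real.coe_toNNReal _ (by positivity)]
  refine (BoundedContinuousFunction.dist_le (by positivity)).2 fun x => ?_
  simp only [profileMap, BoundedContinuousFunction.coe_ofNormedAddCommGroup, Real.dist_eq]
  rw [← integral_sub (Continuous.intervalIntegrable (by fun_prop) _ _)
    (Continuous.intervalIntegrable (by fun_prop) _ _)]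
  rw [← Real.norm_eq_abs]
  refine (norm_integral_le_of_norm_le_const (C := c⁻¹ * dist b b') fun s _ => ?_).trans_eq
    (by rw [sub_zero, abs_one, mul_one])
  rw [add_sub_add_left_eq_sub, ← mul_sub, norm_mul, Real.norm_of_nonneg (by positivity)]
  gcongr
  rw [← dist_eq_norm]
  exact BoundedContinuousFunction.dist_coe_le_dist _

theorem exists_isProfile {c : ℝ} (hc : 1 < c) : ∃ K, IsProfile c K := by
  have hc0 : 0 < c := by linarith
  set b := (profileMap_contracting hc).fixedPoint with hb
  have hfix : profileMap c b = b := (profileMap_contracting hc).fixedPoint_isFixedPt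
  refine ⟨fun x => max x 0 + b x, by fun_prop, ⟨‖b‖, fun x => ?_⟩, fun x => ?_⟩
  · simpa using b.norm_coe_le_norm x
  · have h1 : b x = ∫ s in (0 : ℝ)..1, (max (x - s) 0 - max x 0 + c⁻¹ * b (c * (x - s))) := by
      conv_lhs => rw [← hfix]
      rfl
    -- Homogeneity of `x₊` turns the fixed-point equation for the deviation into the one for `x₊ +
    -- b`.
    have h2 : ∀ s : ℝ, max (x - s) 0 - max x 0 + c⁻¹ * b (c * (x - s)) =
        c⁻¹ * (max (c * x - c * s) 0 + b (c * x - c * s)) - max x 0 := by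
      intro s
      have : max (c * x - c * s) 0 = c * max (x - s) 0 := by
        rw [← mul_sub, mul_max_of_nonneg _ _ hc0.le, mul_zero]
      rw [this]
      field_simp
      ring
    simp only [h2] at h1
    rw [integral_sub (Continuous.intervalIntegrable (by fun_prop) _ _)
      (Continuous.intervalIntegrable (by fun_prop) _ _), integral_const_mul,
      integral_comp_sub_mul (fun u => max u 0 + b u) hc0.ne'] at h1
    simp only [integral_const, sub_zero, mul_one, mul_zero, smul_eq_mul] at h1
    simp only [h1]
    field_simp
    ring

/-- The derivative of a profile. -/
def profileDeriv (c : ℝ) (K : ℝ → ℝ) (x : ℝ) : ℝ := c⁻¹ * (K (c * x) - K (c * x - c))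

/-- The second derivative of a profile. -/
def density (c : ℝ) (K : ℝ → ℝ) (x : ℝ) : ℝ := profileDeriv c K (c * x) - profileDeriv c K (c * x - c)

namespace IsProfile

variable {c : ℝ} {K : ℝ → ℝ}

theorem hasDerivAt (h : IsProfile c K) (hc : 1 < c) (x : ℝ) :
    HasDerivAt K (profileDeriv c K x) x := by
  have hc0 : 0 < c := by linarith
  have hK : K = fun x => (c ^ 2)⁻¹ * ((∫ u in (0 : ℝ)..(c * x), K u) -
      ∫ u in (0 : ℝ)..(c * x - c), K u) := by
    ext x
    rw [integral_interval_sub_left (h.continuous.intervalIntegrable _ _)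
      (h.continuous.intervalIntegrable _ _)]
    exact h.invariant x
  have hF : ∀ y, HasDerivAt (fun y => ∫ u in (0 : ℝ)..y, K u) (K y) y := fun y =>
    integral_hasDerivAt_right (h.continuous.intervalIntegrable _ _)
      (h.continuous.stronglyMeasurableAtFilter _ _) h.continuous.continuousAt
  have l1 : HasDerivAt (fun x : ℝ => c * x) c x := by simpa using (hasDerivAt_id x).const_mul c
  have := (((hF (c * x)).comp x l1).sub ((hF (c * x - c)).comp x (l1.sub_const c))).const_mul
    (c ^ 2)⁻¹
  have e : HasDerivAt K ((c ^ 2)⁻¹ * (K (c * x) * c - K (c * x - c) * c)) x := by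
    convert! this using 1
  convert! e using 1
  rw [profileDeriv]
  field_simp

theorem hasDerivAt_profileDeriv (h : IsProfile c K) (hc : 1 < c) (x : ℝ) :
    HasDerivAt (profileDeriv c K) (density c K x) x := by
  have hc0 : 0 < c := by linarith
  have l1 : HasDerivAt (fun x : ℝ => c * x) c x := by simpa using (hasDerivAt_id x).const_mul c
  have := (((h.hasDerivAt hc (c * x)).comp x l1).sub
    ((h.hasDerivAt hc (c * x - c)).comp x (l1.sub_const c))).const_mul c⁻¹
  convert! this using 1
  rw [density]
  field_simp

/-- Bootstrapping: the derivative is a difference of dilates of `K`, hence as regular as `K`. -/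
theorem contDiff (h : IsProfile c K) (hc : 1 < c) : ContDiff ℝ ∞ K := by
  refine contDiff_infty.2 fun n => ?_
  induction n with
  | zero => exact contDiff_zero.2 h.continuous
  | succ n ih =>
    push_cast
    refine contDiff_succ_iff_deriv.2 ⟨fun x => (h.hasDerivAt hc x).differentiableAt, by simp, ?_⟩
    rw [funext fun x => (h.hasDerivAt hc x).deriv]
    unfold profileDeriv
    fun_prop

theorem contDiff_density (h : IsProfile c K) (hc : 1 < c) : ContDiff ℝ ∞ (density c K) := by
  have := h.contDiff hc
  unfold density profileDeriv
  fun_prop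

theorem density_eq_integral (h : IsProfile c K) (hc : 1 < c) (x : ℝ) :
    density c K x = ∫ u in (c * x - c)..(c * x), density c K u := by
  rw [integral_eq_sub_of_hasDerivAt (fun u _ => h.hasDerivAt_profileDeriv hc u)
    ((h.contDiff_density hc).continuous.intervalIntegrable _ _), density]

theorem lipschitz (h : IsProfile c K) (hc : 1 < c) : ∃ C : NNReal, LipschitzWith C K := by
  have hc0 : 0 < c := by linarith
  obtain ⟨B, hB⟩ := h.bounded
  have hB0 : 0 ≤ B := (abs_nonneg _).trans (hB 0)
  refine ⟨Real.toNNReal (c⁻¹ * (c + 2 * B)), lipschitzWith_of_nnnorm_deriv_le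
    (fun x => (h.hasDerivAt hc x).differentiableAt) fun x => ?_⟩
  rw [← NNReal.coe_le_coe, coe_nnnorm, (h.hasDerivAt hc x).deriv,
    Real.coe_toNNReal _ (by positivity), profileDeriv, norm_mul, Real.norm_of_nonneg (by positivity),
    Real.norm_eq_abs]
  gcongr
  have h1 := abs_le.1 (hB (c * x))
  have h2 := abs_le.1 (hB (c * x - c))
  have h3 : |max (c * x) 0 - max (c * x - c) 0| ≤ c := by
    refine (abs_max_sub_max_le_abs _ _ _).trans ?_
    rw [sub_sub_cancel, abs_of_pos hc0]
  have h3 := abs_le.1 h3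
  exact abs_le.2 ⟨by linarith, by linarith⟩

/-- Otherwise `K` would be affine, which cannot stay within bounded distance of `x₊`. -/
theorem exists_density_ne_zero (h : IsProfile c K) (hc : 1 < c) : ∃ x, density c K x ≠ 0 := by
  by_contra! h0
  have h1 : ∀ x, profileDeriv c K x = profileDeriv c K 0 := fun x =>
    is_const_of_deriv_eq_zero (fun y => (h.hasDerivAt_profileDeriv hc y).differentiableAt)
      (fun y => by rw [(h.hasDerivAt_profileDeriv hc y).deriv, h0]) x 0
  have h2 : ∀ x, K x - profileDeriv c K 0 * x = K 0 := by
    intro x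
    have hd : ∀ y, HasDerivAt (fun x => K x - profileDeriv c K 0 * x) 0 y := fun y => by
      have := (h.hasDerivAt hc y).sub ((hasDerivAt_id y).const_mul (profileDeriv c K 0))
      rw [h1 y, mul_one, sub_self] at this
      exact this
    have := is_const_of_deriv_eq_zero (fun y => (hd y).differentiableAt) (fun y => (hd y).deriv) x 0
    simpa using this
  obtain ⟨B, hB⟩ := h.bounded
  have hB0 : 0 ≤ B := (abs_nonneg _).trans (hB 0)
  have hK0 := abs_le.1 (hB 0)
  -- For affine `K`, `K x + K (-x) = 2 * K 0 ≤ 2 * B`, while closeness to `x₊` gives at least `x - 2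
  -- * B`; any `x > 4 * B` is a contradiction.
  set x := 4 * B + 1
  have hx : 0 ≤ x := by positivity
  have e1 := abs_le.1 (hB x)
  have e2 := abs_le.1 (hB (-x))
  rw [max_eq_left hx] at e1
  rw [max_eq_right (by linarith)] at e2
  rw [max_self] at hK0
  have e3 := h2 x
  have e4 := h2 (-x)
  have : x = 4 * B + 1 := rfl
  linarith

/-- A nonnegative density supported in `[0, c / (c - 1)]` is positive in the interior. -/
theorem density_pos (h : IsProfile c K) (hc : 1 < c) (hnn : ∀ x, 0 ≤ density c K x) {L : ℝ}
    (hL : c * (L - 1) = L) (hsupp : ∀ x, x ∉ Set.Icc 0 L → density c K x = 0) {x : ℝ} (hx0 : 0 < x)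
    (hxL : x < L) : 0 < density c K x := by
  have hcont := (h.contDiff_density hc).continuous
  refine (hnn x).lt_of_ne' fun hzero => ?_
  -- A zero at `y` makes the integral of a nonnegative continuous function over the window of `y`
  -- vanish.
  have step : ∀ y, density c K y = 0 → ∀ u, c * y - c < u → u < c * y → density c K u = 0 := by
    intro y hy u hu1 hu2
    by_contra hne
    have := integral_pos (f := density c K) (a := c * y - c) (b := c * y) (by linarith)
      hcont.continuousOn (fun z _ => hnn z) ⟨u, ⟨hu1.le, hu2.le⟩, (hnn u).lt_of_ne' hne⟩
    rw [← h.density_eq_integral hc, hy] at this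
    exact this.false
  -- The window endpoints `c * y - c` and `c * y` are dilations by `c` about `L` and about `0`.
  -- Iterating spreads the zero set until it covers `[0, L]`.
  have key : ∀ n : ℕ, ∀ u, L - c ^ n * (L - x) < u → u < c ^ n * x → density c K u = 0 := by
    intro n
    induction n with
    | zero =>
      intro u h1 h2
      simp at h1 h2
      linarith
    | succ n ih =>
      intro u h1 h2
      have hcn : 1 ≤ c ^ n := one_le_pow₀ hc.le
      have hle1 : L - c ^ n * (L - x) ≤ x := by nlinarith
      have hle2 : x ≤ c ^ n * x := by nlinarith
      -- choose a zero `y` of the density whose window contains `u`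
      have hy : ∃ y, (y = x ∨ (L - c ^ n * (L - x) < y ∧ y < c ^ n * x)) ∧
          c * y - c < u ∧ u < c * y := by
        rw [pow_succ] at h1 h2
        rcases lt_or_ge u (c * x) with hux | hux
        · rcases lt_or_ge (c * x - c) u with hux' | hux'
          · exact ⟨x, Or.inl rfl, hux', hux⟩
          · -- use `y` slightly below `u / c + 1`
            have hlo : L - c ^ n * (L - x) < u / c + 1 := by
              rw [← sub_lt_iff_lt_add, lt_div_iff₀ (by linarith)]
              linarith
            obtain ⟨y, hy1, hy2⟩ := exists_between (max_lt hlo (by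
              rw [div_lt_iff₀ (by linarith)]
              nlinarith [div_mul_cancel₀ u (by linarith : c ≠ 0)] : u / c < u / c + 1))
            have hu : u / c * c = u := div_mul_cancel₀ u (by linarith)
            have hyx : y < x := by
              have : u / c + 1 ≤ x := by
                rw [← le_sub_iff_add_le, div_le_iff₀ (by linarith)]; linarith
              linarith
            refine ⟨y, Or.inr ⟨(le_max_left _ _).trans_lt hy1, by linarith⟩, by nlinarith, ?_⟩
            have := (le_max_right _ _).trans_lt hy1
            rw [div_lt_iff₀ (by linarith)] at this
            linarith
        · have hhi : u / c < c ^ n * x := by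
            rw [div_lt_iff₀ (by linarith)]; linarith
          obtain ⟨y, hy1, hy2⟩ := exists_between (lt_min hhi (by linarith : u / c < u / c + 1))
          have hu : u / c * c = u := div_mul_cancel₀ u (by linarith)
          have hyx : x < y := by
            have : x ≤ u / c := by rw [le_div_iff₀ (by linarith)]; linarith
            linarith
          refine ⟨y, Or.inr ⟨by linarith, hy2.trans_le (min_le_left _ _)⟩, ?_, ?_⟩
          · have := hy2.trans_le (min_le_right _ _)
            nlinarith
          · rw [div_lt_iff₀ (by linarith)] at hy1
            linarith
      obtain ⟨y, hy, hu1, hu2⟩ := hy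
      refine step y ?_ u hu1 hu2
      rcases hy with rfl | ⟨h3, h4⟩
      · exact hzero
      · exact ih y h3 h4
  obtain ⟨z, hz⟩ := h.exists_density_ne_zero hc
  have hzI : z ∈ Set.Icc 0 L := by
    by_contra hz'
    exact hz (hsupp z hz')
  obtain ⟨n1, hn1⟩ := pow_unbounded_of_one_lt ((L + 1) / (L - x)) hc
  obtain ⟨n2, hn2⟩ := pow_unbounded_of_one_lt ((L + 1) / x) hc
  rw [div_lt_iff₀ (by linarith)] at hn1 hn2
  have hm1 : c ^ n1 ≤ c ^ max n1 n2 := pow_le_pow_right₀ hc.le (le_max_left _ _)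
  have hm2 : c ^ n2 ≤ c ^ max n1 n2 := pow_le_pow_right₀ hc.le (le_max_right _ _)
  refine hz (key (max n1 n2) z ?_ ?_)
  · have := hzI.1
    nlinarith
  · have := hzI.2
    nlinarith

end IsProfile

end Profile

/-! ### Error of Riemann sums for Lipschitz functions. -/

section Riemann

theorem abs_integral_sub_riemannSum_le {C : NNReal} {f : ℝ → ℝ} (hf : LipschitzWith C f) {h : ℝ}
    (hh : 0 ≤ h) (b : ℝ) (M : ℕ) :
    |(∫ u in (b - M * h)..b, f u) - h * ∑ i ∈ Finset.range M, f (b - i * h)| ≤ M * (C * h ^ 2) := by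
  induction M with
  | zero => simp
  | succ M ih =>
    have hi : ∀ a b, IntervalIntegrable f MeasureTheory.volume a b := fun a b =>
      hf.continuous.intervalIntegrable _ _
    have hle : b - ((M + 1 : ℕ) : ℝ) * h ≤ b - M * h := by push_cast; linarith
    have hlen : b - M * h - (b - ((M + 1 : ℕ) : ℝ) * h) = h := by push_cast; ring
    have h1 : |(∫ u in (b - ((M + 1 : ℕ) : ℝ) * h)..(b - M * h), f u) - h * f (b - M * h)| ≤
        C * h ^ 2 := by
      have e : (∫ u in (b - ((M + 1 : ℕ) : ℝ) * h)..(b - M * h), f u) - h * f (b - M * h) =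
          ∫ u in (b - ((M + 1 : ℕ) : ℝ) * h)..(b - M * h), (f u - f (b - M * h)) := by
        rw [intervalIntegral.integral_sub (hi _ _) (by simp), intervalIntegral.integral_const, hlen,
          smul_eq_mul]
      rw [e, ← Real.norm_eq_abs]
      refine (intervalIntegral.norm_integral_le_of_norm_le_const (C := C * h) fun u hu => ?_).trans_eq
        (by rw [hlen, abs_of_nonneg hh]; ring)
      rw [Set.uIoc_of_le hle] at hu
      rw [← dist_eq_norm]
      refine (hf.dist_le_mul _ _).trans ?_
      gcongr
      rw [Real.dist_eq, abs_sub_comm, abs_of_nonneg (by linarith [hu.2])]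
      linarith [hu.1]
    rw [← intervalIntegral.integral_add_adjacent_intervals (hi _ (b - M * h)) (hi _ _),
      Finset.sum_range_succ, mul_add]
    have h2 := abs_add_le
      ((∫ u in (b - ((M + 1 : ℕ) : ℝ) * h)..(b - M * h), f u) - h * f (b - M * h))
      ((∫ u in (b - M * h)..b, f u) - h * ∑ i ∈ Finset.range M, f (b - i * h))
    calc _ = _ := by congr 1; ring
      _ ≤ _ := h2
      _ ≤ C * h ^ 2 + M * (C * h ^ 2) := add_le_add h1 ih
      _ = _ := by push_cast; ring

end Riemann

/-! ### Coefficients of the univariate symbols and their discrete second antiderivative. -/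

section Discrete

theorem act_boxSymbol (N : ℕ) (f : ℤ → ℝ) (α : ℤ) :
    act ℤ (boxSymbol N) f α = (N : ℝ)⁻¹ * ∑ i ∈ Finset.range N, f (α - i) := by
  rw [boxSymbol, act_smul, act_sum, Pi.smul_apply, Finset.sum_apply, smul_eq_mul]
  simp only [act_single, one_mul]

theorem coeff_boxSymbol (N : ℕ) (α : ℤ) :
    (boxSymbol N).coeff α = (N : ℝ)⁻¹ * ∑ i ∈ Finset.range N, if α = i then 1 else 0 := by
  rw [← act_pi_single, act_boxSymbol]
  simp only [Pi.single_apply, sub_eq_zero]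

theorem coeff_uniSymbol_add {r : ℕ} (hr : 1 ≤ r) (n : ℕ) (α : ℤ) :
    (uniSymbol r (n + r)).coeff α =
      ((2 : ℝ) ^ (n + r))⁻¹ * ∑ i ∈ Finset.range (2 ^ (n + r)), (uniSymbol r n).coeff (α - i) := by
  rw [← act_pi_single, uniSymbol_add hr, act_mul, act_boxSymbol]
  simp only [act_pi_single]
  push_cast
  rfl

/-- Induction in steps of length `r`. -/
theorem step_induction {r : ℕ} (hr : 1 ≤ r) {P : ℕ → Prop} (base : ∀ n < r, P n)
    (step : ∀ n, P n → P (n + r)) (n : ℕ) : P n := by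
  induction n using Nat.strong_induction_on with
  | _ n ih =>
    rcases lt_or_ge n r with h | h
    · exact base n h
    · have := step (n - r) (ih _ (by omega))
      rwa [Nat.sub_add_cancel h] at this

theorem coeff_uniSymbol_nonneg {r : ℕ} (hr : 1 ≤ r) (n : ℕ) :
    ∀ α, 0 ≤ (uniSymbol r n).coeff α := by
  induction n using step_induction hr with
  | base n hn =>
    intro α
    rw [uniSymbol_eq_boxSymbol hn.le, coeff_boxSymbol]
    refine mul_nonneg (by positivity) (Finset.sum_nonneg fun i _ => ?_)
    split_ifs <;> norm_num
  | step n ih =>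
    intro α
    rw [coeff_uniSymbol_add hr]
    exact mul_nonneg (by positivity) (Finset.sum_nonneg fun i _ => ih _)

/-- The length of the support of the univariate limit function. -/
def limLength (r : ℕ) : ℝ := 1 + 1 / ((2 : ℝ) ^ r - 1)

theorem one_lt_two_pow_of_one_le {r : ℕ} (hr : 1 ≤ r) : (1 : ℝ) < 2 ^ r :=
  one_lt_pow₀ (by norm_num) (by omega)

theorem one_le_limLength {r : ℕ} (hr : 1 ≤ r) : 1 ≤ limLength r := by
  have := one_lt_two_pow_of_one_le hr
  rw [limLength, le_add_iff_nonneg_right]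
  exact one_div_nonneg.2 (by linarith)

theorem limLength_pos {r : ℕ} (hr : 1 ≤ r) : 0 < limLength r :=
  zero_lt_one.trans_le (one_le_limLength hr)

/-- The fixed-point equation `L = 1 + L / 2 ^ r` for the length of the support, in the form used for
both the discrete and the continuous supports. -/
theorem mul_limLength_sub_one {r : ℕ} (hr : 1 ≤ r) :
    2 ^ r * (limLength r - 1) = limLength r := by
  have : (2 : ℝ) ^ r - 1 ≠ 0 := by have := one_lt_two_pow_of_one_le hr; linarith
  rw [limLength]
  field_simp
  ring

theorem mem_Icc_of_coeff_uniSymbol_ne_zero {r : ℕ} (hr : 1 ≤ r) (n : ℕ) :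
    ∀ α, (uniSymbol r n).coeff α ≠ 0 → 0 ≤ α ∧ (α : ℝ) ≤ limLength r * 2 ^ n := by
  have hL := mul_limLength_sub_one hr
  induction n using step_induction hr with
  | base n hn =>
    intro α h
    rw [uniSymbol_eq_boxSymbol hn.le, coeff_boxSymbol] at h
    obtain ⟨i, hi, h'⟩ := Finset.exists_ne_zero_of_sum_ne_zero (right_ne_zero_of_mul h)
    have hα : α = i := by
      by_contra hne
      exact h' (if_neg hne)
    subst hα
    refine ⟨by positivity, ?_⟩
    have : (i : ℝ) ≤ 2 ^ n := by exact_mod_cast (Finset.mem_range.1 hi).le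
    push_cast
    exact this.trans (le_mul_of_one_le_left (by positivity) (one_le_limLength hr))
  | step n ih =>
    intro α h
    rw [coeff_uniSymbol_add hr] at h
    obtain ⟨i, hi, h'⟩ := Finset.exists_ne_zero_of_sum_ne_zero (right_ne_zero_of_mul h)
    obtain ⟨h1, h2⟩ := ih _ h'
    refine ⟨by omega, ?_⟩
    have : (i : ℝ) ≤ 2 ^ (n + r) := by exact_mod_cast (Finset.mem_range.1 hi).le
    push_cast at h2
    have e : limLength r * 2 ^ (n + r) = 2 ^ (n + r) + limLength r * 2 ^ n := by
      rw [pow_add]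
      linear_combination (2 : ℝ) ^ n * hL
    linarith

/-- The discrete fundamental solution of the second difference. -/
def ramp (j : ℤ) : ℝ := max (j + 1 : ℝ) 0

theorem abs_ramp_sub_le (α : ℤ) (i : ℕ) : |ramp (α - i) - max (α : ℝ) 0| ≤ i + 1 := by
  refine (abs_max_sub_max_le_abs _ _ _).trans ?_
  push_cast
  rw [abs_le]
  constructor <;> linarith [(Nat.cast_nonneg i : (0 : ℝ) ≤ i)]

theorem second_difference_ramp :
    act ℤ ((1 - AddMonoidAlgebra.single 1 1) * (1 - AddMonoidAlgebra.single 1 1)) ramp =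
      Pi.single 0 1 := by
  ext α
  have h : (1 - AddMonoidAlgebra.single 1 1) * (1 - AddMonoidAlgebra.single 1 1) =
      AddMonoidAlgebra.single (0 : ℤ) (1 : ℝ) + (AddMonoidAlgebra.single 1 (-2) +
        AddMonoidAlgebra.single 2 1) := by
    have e : AddMonoidAlgebra.single (1 : ℤ) (1 : ℝ) * AddMonoidAlgebra.single (1 : ℤ) (1 : ℝ) =
        AddMonoidAlgebra.single 2 1 := by
      rw [AddMonoidAlgebra.single_mul_single]; norm_num
    have e2 : AddMonoidAlgebra.single (1 : ℤ) (-2 : ℝ) =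
        -AddMonoidAlgebra.single 1 1 - AddMonoidAlgebra.single 1 1 := by
      ext; simp only [AddMonoidAlgebra.coeff_single, AddMonoidAlgebra.coeff_sub,
        AddMonoidAlgebra.coeff_neg, ← Finsupp.single_neg, ← Finsupp.single_sub]; norm_num
    rw [e2, ← e, ← AddMonoidAlgebra.one_def]
    ring
  rw [h, act_add, act_add, Pi.add_apply, Pi.add_apply, act_single, act_single, act_single,
    Pi.single_apply]
  simp only [ramp]
  split_ifs with h0
  · subst h0; norm_num
  · rcases lt_or_gt_of_ne h0 with h1 | h1
    · have : (α : ℝ) ≤ -1 := by exact_mod_cast Int.le_sub_one_of_lt h1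
      push_cast
      rw [max_eq_right (by linarith), max_eq_right (by linarith), max_eq_right (by linarith)]
      norm_num
    · have : (1 : ℝ) ≤ α := by exact_mod_cast h1
      push_cast
      rw [max_eq_left (by linarith), max_eq_left (by linarith), max_eq_left (by linarith)]
      ring

theorem sub_mul_boxSymbol {N : ℕ} :
    (1 - AddMonoidAlgebra.single 1 1) * boxSymbol N =
      (N : ℝ)⁻¹ • (1 - AddMonoidAlgebra.single (N : ℤ) 1) := by
  rw [boxSymbol, mul_smul_comm]
  congr 1
  have : ∀ i : ℕ, AddMonoidAlgebra.single (i : ℤ) (1 : ℝ) = AddMonoidAlgebra.single 1 1 ^ i := by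
    intro i
    simp
  simp only [this]
  exact mul_neg_geom_sum _ _

/-- The discrete analogue of the profile. -/
def rampSum (r n : ℕ) (α : ℤ) : ℝ := ((2 : ℝ) ^ n)⁻¹ * act ℤ (uniSymbol r n) ramp α

theorem rampSum_add {r : ℕ} (hr : 1 ≤ r) (n : ℕ) (α : ℤ) :
    rampSum r (n + r) α = ((2 : ℝ) ^ r)⁻¹ * ((2 : ℝ) ^ (n + r))⁻¹ *
      ∑ i ∈ Finset.range (2 ^ (n + r)), rampSum r n (α - i) := by
  simp only [rampSum, ← Finset.mul_sum]
  rw [uniSymbol_add hr, act_mul, act_boxSymbol]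
  push_cast
  rw [pow_add]
  field_simp

/-- The exact discrete counterpart of the formula for `density` in terms of `K`. Each of the two
factors `1 - z` telescopes against one of the two box symbols split off from `uniSymbol r (n + r +
r)`, leaving long-range differences. -/
theorem two_pow_mul_coeff_uniSymbol {r : ℕ} (hr : 1 ≤ r) (n : ℕ) (α : ℤ) :
    2 ^ (n + r + r) * (uniSymbol r (n + r + r)).coeff α =
      ((2 : ℝ) ^ r)⁻¹ * (rampSum r n α - rampSum r n (α - 2 ^ (n + r))) -
      ((2 : ℝ) ^ r)⁻¹ * (rampSum r n (α - 2 ^ (n + r + r)) -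
        rampSum r n (α - 2 ^ (n + r + r) - 2 ^ (n + r))) := by
  have key : uniSymbol r (n + r + r) *
      ((1 - AddMonoidAlgebra.single 1 1) * (1 - AddMonoidAlgebra.single 1 1)) =
      ((2 : ℝ) ^ (n + r + r))⁻¹ • ((1 - AddMonoidAlgebra.single (2 ^ (n + r + r) : ℤ) 1) *
        (((2 : ℝ) ^ (n + r))⁻¹ • ((1 - AddMonoidAlgebra.single (2 ^ (n + r) : ℤ) 1) *
          uniSymbol r n))) := by
    have e1 := sub_mul_boxSymbol (N := 2 ^ (n + r + r))
    have e2 := sub_mul_boxSymbol (N := 2 ^ (n + r))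
    push_cast at e1 e2
    rw [← smul_mul_assoc, ← smul_mul_assoc, ← e1, ← e2, uniSymbol_add hr, uniSymbol_add hr]
    ring
  have sub_act : ∀ (m : ℤ) (f : ℤ → ℝ) (β : ℤ),
      act ℤ (1 - AddMonoidAlgebra.single m 1) f β = f β - f (β - m) := by
    intro m f β
    rw [map_sub, map_one, LinearMap.sub_apply, Pi.sub_apply, act_single, one_mul]
    rfl
  rw [← act_pi_single, ← second_difference_ramp, ← act_mul, key, act_smul, act_mul]
  simp only [Pi.smul_apply, smul_eq_mul, sub_act, act_smul, act_mul, rampSum]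
  rw [pow_add 2 n r]
  field_simp

end Discrete

/-! ### Uniform convergence of the univariate scheme to the density. -/

section Convergence

variable {r : ℕ} {K : ℝ → ℝ}

theorem abs_rampSum_sub_le {n : ℕ} (hn : n ≤ r) (α : ℤ) :
    |rampSum r n α - max ((α : ℝ) / 2 ^ n) 0| ≤ 2 := by
  have e : max ((α : ℝ) / 2 ^ n) 0 = ((2 : ℝ) ^ n)⁻¹ * (((2 ^ n : ℕ) : ℝ)⁻¹ *
      ∑ i ∈ Finset.range (2 ^ n), max (α : ℝ) 0) := by
    rw [Finset.sum_const, Finset.card_range, nsmul_eq_mul, inv_mul_cancel_left₀ (by positivity),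
      mul_max_of_nonneg _ _ (by positivity), mul_zero, div_eq_inv_mul]
  rw [rampSum, uniSymbol_eq_boxSymbol hn, act_boxSymbol, e, ← mul_sub, ← mul_sub,
    ← Finset.sum_sub_distrib, abs_mul, abs_mul, abs_of_nonneg (by positivity),
    abs_of_nonneg (by positivity)]
  have hb : |∑ i ∈ Finset.range (2 ^ n), (ramp (α - i) - max (α : ℝ) 0)| ≤
      ((2 ^ n : ℕ) : ℝ) * 2 ^ n := by
    refine (Finset.abs_sum_le_sum_abs _ _).trans ?_
    rw [← nsmul_eq_mul]
    refine (Finset.sum_le_card_nsmul _ _ _ fun i hi => ?_).trans_eq (by rw [Finset.card_range])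
    refine (abs_ramp_sub_le α i).trans ?_
    exact_mod_cast Finset.mem_range.1 hi
  calc _ ≤ ((2 : ℝ) ^ n)⁻¹ * (((2 ^ n : ℕ) : ℝ)⁻¹ * (((2 ^ n : ℕ) : ℝ) * 2 ^ n)) := by gcongr
    _ = 1 := by push_cast; field_simp
    _ ≤ 2 := by norm_num

/-- The profile and `rampSum` obey the same averaging recursion, one with an integral and the other
with its Riemann sum. A step of length `r` divides the old error by `2 ^ r` and adds `C / 2 ^ (n +
r)`, whence the linear term in `n`. -/
theorem exists_abs_profile_sub_rampSum_le (hr : 1 ≤ r) (hK : IsProfile (2 ^ r) K) :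
    ∃ B D : ℝ, 0 ≤ B ∧ 0 ≤ D ∧ ∀ (n : ℕ) (α : ℤ),
      |K ((α : ℝ) / 2 ^ n) - rampSum r n α| ≤ (B + D * n) / 2 ^ n := by
  obtain ⟨B, hB⟩ := hK.bounded
  have hB0 : 0 ≤ B := (abs_nonneg _).trans (hB 0)
  obtain ⟨C, hC⟩ := hK.lipschitz (one_lt_two_pow_of_one_le hr)
  refine ⟨2 ^ r * (B + 2), C, by positivity, by positivity, ?_⟩
  intro n
  induction n using step_induction hr with
  | base n hn =>
    intro α
    calc _ ≤ |K ((α : ℝ) / 2 ^ n) - max ((α : ℝ) / 2 ^ n) 0| +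
          |max ((α : ℝ) / 2 ^ n) 0 - rampSum r n α| := abs_sub_le _ _ _
      _ ≤ B + 2 := add_le_add (hB _) (by rw [abs_sub_comm]; exact abs_rampSum_sub_le hn.le α)
      _ ≤ 2 ^ r * (B + 2) / 2 ^ n := by
        rw [le_div_iff₀ (by positivity), mul_comm]
        gcongr
        norm_num
      _ ≤ _ := by gcongr; exact le_add_of_nonneg_right (by positivity)
  | step n ih =>
    intro α
    have hinv := hK.invariant ((α : ℝ) / 2 ^ (n + r))
    have hx : (2 : ℝ) ^ r * ((α : ℝ) / 2 ^ (n + r)) = α / 2 ^ n := by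
      rw [pow_add]; field_simp
    have hlen : (α : ℝ) / 2 ^ n - 2 ^ r = α / 2 ^ n - ((2 ^ (n + r) : ℕ) : ℝ) * (1 / 2 ^ n) := by
      push_cast; rw [pow_add]; field_simp
    rw [hx, hlen] at hinv
    have hR := abs_integral_sub_riemannSum_le hC (h := 1 / 2 ^ n) (by positivity) ((α : ℝ) / 2 ^ n)
      (2 ^ (n + r))
    have hS : |∑ i ∈ Finset.range (2 ^ (n + r)), K ((α : ℝ) / 2 ^ n - i * (1 / 2 ^ n)) -
        ∑ i ∈ Finset.range (2 ^ (n + r)), rampSum r n (α - i)| ≤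
        2 ^ (n + r) * ((2 ^ r * (B + 2) + C * n) / 2 ^ n) := by
      rw [← Finset.sum_sub_distrib]
      refine (Finset.abs_sum_le_sum_abs _ _).trans ?_
      refine (Finset.sum_le_card_nsmul _ _ _ fun i hi => ?_).trans_eq
        (by rw [Finset.card_range, nsmul_eq_mul]; push_cast; rfl)
      have := ih (α - i)
      push_cast at this
      rwa [sub_div, div_eq_mul_one_div (i : ℝ)] at this
    rw [hinv, rampSum_add hr]
    set I := ∫ u in ((α : ℝ) / 2 ^ n - ((2 ^ (n + r) : ℕ) : ℝ) * (1 / 2 ^ n))..((α : ℝ) / 2 ^ n), K u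
    set S := ∑ i ∈ Finset.range (2 ^ (n + r)), K ((α : ℝ) / 2 ^ n - i * (1 / 2 ^ n))
    set T := ∑ i ∈ Finset.range (2 ^ (n + r)), rampSum r n (α - i)
    have e : (((2 : ℝ) ^ r) ^ 2)⁻¹ * I - (2 ^ r)⁻¹ * (2 ^ (n + r))⁻¹ * T =
        (((2 : ℝ) ^ r) ^ 2)⁻¹ * (I - 1 / 2 ^ n * S) +
        (2 ^ r)⁻¹ * (2 ^ (n + r))⁻¹ * (S - T) := by
      rw [pow_add]; field_simp; ring
    rw [e]
    refine (abs_add_le _ _).trans ?_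
    rw [abs_mul, abs_mul, abs_of_pos (by positivity : 0 < (((2 : ℝ) ^ r) ^ 2)⁻¹),
      abs_of_pos (by positivity : 0 < ((2 : ℝ) ^ r)⁻¹ * (2 ^ (n + r))⁻¹)]
    calc _ ≤ (((2 : ℝ) ^ r) ^ 2)⁻¹ * (((2 ^ (n + r) : ℕ) : ℝ) * (C * (1 / 2 ^ n) ^ 2)) +
          (2 ^ r)⁻¹ * (2 ^ (n + r))⁻¹ * (2 ^ (n + r) * ((2 ^ r * (B + 2) + C * n) / 2 ^ n)) := by
          gcongr
      _ = (2 ^ r * (B + 2) + C * (n + 1)) / 2 ^ (n + r) := by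
          push_cast; rw [pow_add]; field_simp; ring
      _ ≤ _ := by
          have : (1 : ℝ) ≤ r := by exact_mod_cast hr
          push_cast
          gcongr

theorem density_tendsto (hr : 1 ≤ r) (hK : IsProfile (2 ^ r) K) {ε : ℝ} (hε : 0 < ε) :
    ∀ᶠ n : ℕ in atTop, ∀ α : ℤ,
      |density (2 ^ r) K ((α : ℝ) / 2 ^ n) - 2 ^ n * (uniSymbol r n).coeff α| ≤ ε := by
  obtain ⟨B, D, hB, hD, h⟩ := exists_abs_profile_sub_rampSum_le hr hK
  have hlim : Tendsto (fun m : ℕ => (B + D * m) / 2 ^ m) atTop (𝓝 0) := by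
    have h1 : Tendsto (fun m : ℕ => B * (1 / 2 : ℝ) ^ m) atTop (𝓝 (B * 0)) :=
      (tendsto_pow_atTop_nhds_zero_of_lt_one (by norm_num) (by norm_num)).const_mul B
    have h2 : Tendsto (fun m : ℕ => D * ((m : ℝ) * (1 / 2 : ℝ) ^ m)) atTop (𝓝 (D * 0)) :=
      (tendsto_self_mul_const_pow_of_lt_one (by norm_num) (by norm_num)).const_mul D
    have h3 := h1.add h2
    simp only [mul_zero, add_zero] at h3
    refine h3.congr fun m => ?_
    rw [one_div, inv_pow]
    ring
  -- The density is `(2 ^ r)⁻¹ ≤ 1` times a combination of four values of `K`, each contributing `ε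
  -- / 4`.
  have hev := hlim.eventually_le_const (by positivity : (0 : ℝ) < ε / 4)
  filter_upwards [(tendsto_sub_atTop_nat (r + r)).eventually hev, eventually_ge_atTop (r + r)]
    with n hm hn α
  obtain ⟨m, rfl⟩ : ∃ m, n = m + r + r := ⟨n - (r + r), by omega⟩
  rw [show m + r + r - (r + r) = m by omega] at hm
  rw [two_pow_mul_coeff_uniSymbol hr]
  have e1 : (2 : ℝ) ^ r * (2 ^ r * ((α : ℝ) / 2 ^ (m + r + r))) = (α : ℤ) / 2 ^ m := by
    rw [pow_add, pow_add]; field_simp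
  have e2 : (α : ℝ) / 2 ^ m - 2 ^ r = ((α - 2 ^ (m + r) : ℤ) : ℝ) / 2 ^ m := by
    push_cast; rw [pow_add]; field_simp
  have e3 : (2 : ℝ) ^ r * (2 ^ r * ((α : ℝ) / 2 ^ (m + r + r)) - 2 ^ r) =
      ((α - 2 ^ (m + r + r) : ℤ) : ℝ) / 2 ^ m := by
    push_cast; rw [pow_add, pow_add]; field_simp
  have e4 : ((α - 2 ^ (m + r + r) : ℤ) : ℝ) / 2 ^ m - 2 ^ r =
      ((α - 2 ^ (m + r + r) - 2 ^ (m + r) : ℤ) : ℝ) / 2 ^ m := by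
    push_cast; rw [pow_add, pow_add]; field_simp
  rw [density, profileDeriv, profileDeriv, e3, e4, e1, e2]
  have b1 := abs_le.1 ((h m α).trans hm)
  have b2 := abs_le.1 ((h m (α - 2 ^ (m + r))).trans hm)
  have b3 := abs_le.1 ((h m (α - 2 ^ (m + r + r))).trans hm)
  have b4 := abs_le.1 ((h m (α - 2 ^ (m + r + r) - 2 ^ (m + r))).trans hm)
  rw [← mul_sub, ← mul_sub, ← mul_sub, abs_mul, abs_of_pos (by positivity)]
  have hc1 : ((2 : ℝ) ^ r)⁻¹ ≤ 1 := inv_le_one_of_one_le₀ (one_lt_two_pow_of_one_le hr).le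
  refine (mul_le_of_le_one_left (abs_nonneg _) hc1).trans ?_
  exact abs_le.2 ⟨by linarith [b1.1, b2.2, b3.2, b4.1], by linarith [b1.2, b2.1, b3.1, b4.2]⟩

theorem tendsto_floor_two_pow (x : ℝ) :
    Tendsto (fun n : ℕ => (⌊(2 : ℝ) ^ n * x⌋ : ℝ) / 2 ^ n) atTop (𝓝 x) := by
  have hlow : Tendsto (fun n : ℕ => x - (1 / 2 : ℝ) ^ n) atTop (𝓝 x) := by
    simpa using (tendsto_pow_atTop_nhds_zero_of_lt_one (r := (1 / 2 : ℝ)) (by norm_num)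
      (by norm_num)).const_sub x
  refine tendsto_of_tendsto_of_tendsto_of_le_of_le hlow tendsto_const_nhds (fun n => ?_) fun n => ?_
  · have h := (Int.sub_one_lt_floor ((2 : ℝ) ^ n * x)).le
    simp only
    rw [le_div_iff₀ (by positivity), sub_mul, ← mul_pow]
    norm_num
    linarith
  · simp only
    rw [div_le_iff₀ (by positivity), mul_comm]
    exact Int.floor_le _

/-- Carries nonnegativity and the support bound from the coefficients to the density. -/
theorem tendsto_coeff_floor (hr : 1 ≤ r) (hK : IsProfile (2 ^ r) K) (x : ℝ) :
    Tendsto (fun n : ℕ => 2 ^ n * (uniSymbol r n).coeff ⌊(2 : ℝ) ^ n * x⌋) atTop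
      (𝓝 (density (2 ^ r) K x)) := by
  have h1 := ((hK.contDiff_density (one_lt_two_pow_of_one_le hr)).continuous.tendsto x).comp
    (tendsto_floor_two_pow x)
  refine h1.congr_dist (Metric.tendsto_nhds.2 fun ε hε => ?_)
  filter_upwards [density_tendsto hr hK (half_pos hε)] with n hn
  simp only [Real.dist_eq, sub_zero, abs_abs, Function.comp_apply]
  exact (hn ⌊(2 : ℝ) ^ n * x⌋).trans_lt (half_lt_self hε)

theorem exists_density (hr : 1 ≤ r) : ∃ p : ℝ → ℝ, ContDiff ℝ ∞ p ∧ (∀ x, 0 ≤ p x) ∧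
    (∀ x, x ∉ Set.Icc 0 (limLength r) → p x = 0) ∧ (∀ x ∈ Set.Ioo 0 (limLength r), 0 < p x) ∧
    ∀ ε > 0, ∀ᶠ n : ℕ in atTop, ∀ α : ℤ,
      |p ((α : ℝ) / 2 ^ n) - 2 ^ n * (uniSymbol r n).coeff α| ≤ ε := by
  have hc := one_lt_two_pow_of_one_le hr
  obtain ⟨K, hK⟩ := exists_isProfile hc
  have hnn : ∀ x, 0 ≤ density (2 ^ r) K x := fun x =>
    ge_of_tendsto' (tendsto_coeff_floor hr hK x) fun n =>
      mul_nonneg (by positivity) (coeff_uniSymbol_nonneg hr n _)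
  have hsupp : ∀ x, x ∉ Set.Icc 0 (limLength r) → density (2 ^ r) K x = 0 := by
    intro x hx
    refine tendsto_nhds_unique (tendsto_coeff_floor hr hK x) (tendsto_const_nhds.congr' ?_)
    have hx' : x < 0 ∨ limLength r < x := by
      by_contra! h
      exact hx h
    have hev : ∀ᶠ n : ℕ in atTop, 0 ≤ x → limLength r < (⌊(2 : ℝ) ^ n * x⌋ : ℝ) / 2 ^ n := by
      rcases hx' with h | h
      · exact Eventually.of_forall fun n h' => absurd h' (not_le.2 h)
      · filter_upwards [(tendsto_floor_two_pow x).eventually_const_lt h] with n hn _ using hn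
    filter_upwards [hev] with n hn
    by_contra hne
    obtain ⟨h1, h2⟩ := mem_Icc_of_coeff_uniSymbol_ne_zero hr n _
      (right_ne_zero_of_mul (Ne.symm hne))
    have hx0 : 0 ≤ x := by
      have h3 := Int.le_floor.1 h1
      push_cast at h3
      exact nonneg_of_mul_nonneg_right h3 (by positivity)
    have h4 := hn hx0
    rw [lt_div_iff₀ (by positivity)] at h4
    exact absurd h2 (not_le.2 h4)
  exact ⟨density (2 ^ r) K, hK.contDiff_density hc, hnn, hsupp,
    fun x hx => hK.density_pos hc hnn (mul_limLength_sub_one hr) hsupp hx.1 hx.2,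
    fun ε hε => density_tendsto hr hK hε⟩

end Convergence

/-! ### Factorisation of the bivariate symbols along the three directions. -/

section ThreeDirections

/-- The homomorphism `i ↦ i • v`. -/
def lineHom (v : Lattice 2) : ℤ →+ Lattice 2 := zmultiplesHom _ v

theorem lineHom_apply (v : Lattice 2) (i : ℤ) : lineHom v i = i • v := rfl

/-- The substitution `z ↦ z ^ v`. -/
def lineMap (v : Lattice 2) : AddMonoidAlgebra ℝ ℤ →+* Mask 2 :=
  AddMonoidAlgebra.mapDomainRingHom ℝ (lineHom v)

theorem lineMap_single (v : Lattice 2) (i : ℤ) (c : ℝ) :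
    lineMap v (AddMonoidAlgebra.single i c) = AddMonoidAlgebra.single (i • v) c := by
  rw [lineMap, AddMonoidAlgebra.mapDomainRingHom_apply, AddMonoidAlgebra.mapDomain_single,
    lineHom_apply]

theorem lineMap_halfMask (v : Lattice 2) :
    lineMap v halfMask = (1 / 2 : ℝ) • (1 + AddMonoidAlgebra.single v 1) := by
  have h : ∀ w : AddMonoidAlgebra ℝ ℤ, lineMap v ((1 / 2 : ℝ) • w) = (1 / 2 : ℝ) • lineMap v w := by
    intro w
    induction w using AddMonoidAlgebra.induction_linear with
    | zero => simp
    | add a b ha hb => rw [smul_add, map_add, map_add, ha, hb, smul_add]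
    | single i c =>
      rw [AddMonoidAlgebra.smul_single, lineMap_single, lineMap_single,
        AddMonoidAlgebra.smul_single]
  rw [halfMask, h, map_add, map_one, lineMap_single, one_smul]

theorem dilate_lineMap (v : Lattice 2) (a : AddMonoidAlgebra ℝ ℤ) :
    dilate _ 2 (lineMap v a) = lineMap v (dilate _ 2 a) := by
  induction a using AddMonoidAlgebra.induction_linear with
  | zero => simp
  | add a b ha hb => simp only [map_add, ha, hb]
  | single i c =>
    rw [lineMap_single, dilate_single, dilate_single, lineMap_single, smul_assoc]

/-- The product of a univariate symbol along the three directions. -/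
def threeDirProd (a : AddMonoidAlgebra ℝ ℤ) : Mask 2 :=
  lineMap ![1, 0] a * lineMap ![0, 1] a * lineMap ![1, 1] a

theorem threeDirProd_mul (a b : AddMonoidAlgebra ℝ ℤ) :
    threeDirProd (a * b) = threeDirProd a * threeDirProd b := by
  simp only [threeDirProd, map_mul]
  ring

theorem threeDirMask_eq (m : ℕ) : threeDirMask m = (4 : ℝ) • threeDirProd (halfMask ^ m) := by
  rw [threeDirMask, boxMask, Multiset.map_nsmul, Multiset.prod_nsmul]
  simp only [Multiset.insert_eq_cons, Multiset.map_cons, Multiset.map_singleton, Multiset.prod_cons,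
    Multiset.prod_singleton, ← lineMap_halfMask, threeDirProd, map_pow, mul_pow, mul_assoc]
  norm_num

theorem iterMask_repeatedMasks (r n : ℕ) :
    iterMask (repeatedMasks r) n = (4 : ℝ) ^ n • threeDirProd (uniSymbol r n) := by
  induction n with
  | zero => simp [iterMask, threeDirProd, uniSymbol]
  | succ n ih =>
    rw [iterMask, ih, repeatedMasks, threeDirMask_eq, uniSymbol, threeDirProd_mul, dilate_smul,
      smul_mul_smul_comm, pow_succ' (4 : ℝ) n]
    simp only [threeDirProd, map_mul, dilate_lineMap]

/-- Once the multiple `t` of `(1, 1)` is chosen, the multiples of `(1, 0)` and `(0, 1)` are forced.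
-/
theorem coeff_threeDirProd (a : AddMonoidAlgebra ℝ ℤ) (α : Lattice 2) :
    (threeDirProd a).coeff α =
      a.coeff.sum fun t c => c * (a.coeff (α 0 - t) * a.coeff (α 1 - t)) := by
  have single_sum : ∀ m : ℤ, (a.coeff.sum fun i c => c * if m = i then (1 : ℝ) else 0) =
      a.coeff m := by
    intro m
    simpa using Eq.symm
  have h2 : ∀ β : Lattice 2, act _ (lineMap ![1, 0] a * lineMap ![0, 1] a) (Pi.single 0 1) β =
      a.coeff (β 0) * a.coeff (β 1) := by
    intro β
    rw [act_mul, lineMap, act_map, lineMap, ← single_sum (β 0), Finsupp.sum, Finsupp.sum,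
      Finset.sum_mul]
    refine Finset.sum_congr rfl fun i _ => ?_
    rw [act_map, mul_assoc]
    congr 1
    rw [← single_sum (β 1), Finsupp.sum, Finsupp.sum, Finset.mul_sum]
    refine Finset.sum_congr rfl fun j _ => ?_
    rw [lineHom_apply, lineHom_apply, Pi.single_apply]
    have : β - i • ![1, 0] - j • ![0, 1] = 0 ↔ β 0 = i ∧ β 1 = j := by
      rw [funext_iff, Fin.forall_fin_two]
      simp [sub_eq_zero]
      rfl
    simp only [this]
    by_cases h1 : β 0 = i <;> by_cases h2 : β 1 = j <;> simp [h1, h2]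
  rw [← act_pi_single, threeDirProd, mul_comm, act_mul]
  conv_lhs => rw [lineMap]
  rw [act_map]
  refine Finset.sum_congr rfl fun t _ => ?_
  simp only []
  rw [h2, lineHom_apply]
  simp

theorem threeDirProd_coeff_eq_sum (a : AddMonoidAlgebra ℝ ℤ) (α : Lattice 2) {s : Finset ℤ}
    (hs : ∀ t, a.coeff t ≠ 0 → t ∈ s) :
    (threeDirProd a).coeff α = ∑ t ∈ s, a.coeff t * a.coeff (α 0 - t) * a.coeff (α 1 - t) := by
  rw [coeff_threeDirProd]
  simp only [← mul_assoc]
  exact Finsupp.sum_of_support_subset _ (fun t ht => hs t (by simpa using ht)) _ (by simp)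

theorem coeff_iterMask_repeatedMasks_ne_zero {r : ℕ} (hr : 1 ≤ r) {n : ℕ} {α : Lattice 2}
    (h : (iterMask (repeatedMasks r) n).coeff α ≠ 0) (i : Fin 2) :
    0 ≤ α i ∧ (α i : ℝ) ≤ 2 * limLength r * 2 ^ n := by
  rw [iterMask_repeatedMasks, AddMonoidAlgebra.coeff_smul, Finsupp.smul_apply,
    coeff_threeDirProd] at h
  obtain ⟨t, _, ht⟩ := Finset.exists_ne_zero_of_sum_ne_zero (right_ne_zero_of_smul h)
  have key : ∀ β, (uniSymbol r n).coeff t ≠ 0 → (uniSymbol r n).coeff (β - t) ≠ 0 →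
      0 ≤ β ∧ (β : ℝ) ≤ 2 * limLength r * 2 ^ n := by
    intro β h1 h2
    have h1 := mem_Icc_of_coeff_uniSymbol_ne_zero hr n _ h1
    have h2 := mem_Icc_of_coeff_uniSymbol_ne_zero hr n _ h2
    refine ⟨by linarith [h1.1, h2.1], ?_⟩
    have h3 := h2.2
    push_cast at h3
    linarith [h1.2]
  have h1 := left_ne_zero_of_mul ht
  have h2 := right_ne_zero_of_mul ht
  fin_cases i
  · exact key _ h1 (left_ne_zero_of_mul h2)
  · exact key _ h1 (right_ne_zero_of_mul h2)

end ThreeDirections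

/-! ### The bivariate limit function: smoothness, non-vanishing set, convergence. -/

section LimitFunction

/-- The density of `(U + W, V + W)` where `U`, `V`, `W` are independent with density `p`. -/
def limitFun (p : ℝ → ℝ) (x : EuclideanSpace ℝ (Fin 2)) : ℝ :=
  ∫ t, p t * p (x 0 - t) * p (x 1 - t)

variable {p : ℝ → ℝ} {L : ℝ}

theorem contDiff_limitFun (hp : ContDiff ℝ ∞ p) (hsupp : ∀ x, x ∉ Set.Icc 0 L → p x = 0) :
    ContDiff ℝ ∞ (limitFun p) := by
  rw [← contDiffOn_univ]
  -- The integral is the convolution at `0` of the constant `1` with the integrand reflected in `t`,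
  -- the point `x` being a parameter.
  have := MeasureTheory.contDiffOn_convolution_right_with_param_comp (𝕜 := ℝ) (n := ⊤)
    (μ := MeasureTheory.volume) (ContinuousLinearMap.mul ℝ ℝ)
    (s := (Set.univ : Set (EuclideanSpace ℝ (Fin 2)))) (v := fun _ => (0 : ℝ))
    (f := fun _ => (1 : ℝ)) (g := fun x s => p (-s) * p (x 0 + s) * p (x 1 + s))
    (k := Set.Icc (-L) 0) contDiffOn_const isOpen_univ isCompact_Icc
    (fun x s _ hs => by
      rw [hsupp (-s), zero_mul, zero_mul]
      rintro ⟨h1, h2⟩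
      exact hs ⟨by linarith, by linarith⟩)
    (MeasureTheory.locallyIntegrable_const _)
    (by
      refine ContDiff.contDiffOn ?_
      change ContDiff ℝ ∞ fun q : EuclideanSpace ℝ (Fin 2) × ℝ =>
        p (-q.2) * p (q.1 0 + q.2) * p (q.1 1 + q.2)
      fun_prop)
  refine this.congr fun x _ => ?_
  simp [limitFun, MeasureTheory.convolution, sub_eq_add_neg]

theorem continuous_integrand (hp : Continuous p) (x y : ℝ) :
    Continuous fun t => p t * p (x - t) * p (y - t) := by fun_prop

theorem limitFun_ne_zero_iff (hp : Continuous p) (hnn : ∀ x, 0 ≤ p x)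
    (hsupp : ∀ x, x ∉ Set.Icc 0 L → p x = 0) (hpos : ∀ x ∈ Set.Ioo 0 L, 0 < p x)
    (x : EuclideanSpace ℝ (Fin 2)) :
    limitFun p x ≠ 0 ↔ ∃ t ∈ Set.Ioo 0 L, x 0 - t ∈ Set.Ioo 0 L ∧ x 1 - t ∈ Set.Ioo 0 L := by
  have hmem : ∀ y, p y ≠ 0 ↔ y ∈ Set.Ioo 0 L := by
    intro y
    refine ⟨fun hy => ?_, fun hy => (hpos y hy).ne'⟩
    -- The non-vanishing set of a continuous function is open, so the endpoints `0` and `L` drop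
    -- out.
    have hsub : Function.support p ⊆ interior (Set.Icc 0 L) :=
      interior_maximal (fun z hz => by
        by_contra h
        exact hz (hsupp z h)) hp.isOpen_support
    rw [interior_Icc] at hsub
    exact hsub hy
  have hcont := continuous_integrand hp (x 0) (x 1)
  have hcs : HasCompactSupport fun t => p t * p (x 0 - t) * p (x 1 - t) :=
    HasCompactSupport.intro (isCompact_Icc (a := 0) (b := L)) fun t ht => by
      simp [hsupp t ht]
  constructor
  · intro h
    by_contra! hne
    refine h (MeasureTheory.integral_eq_zero_of_ae (Eventually.of_forall fun t => ?_))
    simp only [Pi.zero_apply]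
    by_contra h0
    have h1 := left_ne_zero_of_mul h0
    exact hne t ((hmem _).1 (left_ne_zero_of_mul h1)) ((hmem _).1 (right_ne_zero_of_mul h1))
      ((hmem _).1 (right_ne_zero_of_mul h0))
  · rintro ⟨t, h1, h2, h3⟩
    refine (hcont.integral_pos_of_hasCompactSupport_nonneg_nonzero hcs
      (fun s => mul_nonneg (mul_nonneg (hnn _) (hnn _)) (hnn _)) (x := t) ?_).ne'
    exact mul_ne_zero (mul_ne_zero ((hmem _).2 h1) ((hmem _).2 h2)) ((hmem _).2 h3)

theorem abs_mul_mul_sub_le {M a b c a' b' c' : ℝ} (ha : |a| ≤ M) (hb : |b| ≤ M) (hb' : |b'| ≤ M)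
    (ha' : |a'| ≤ M) (hc : |c| ≤ M) :
    |a * b * c - a' * b' * c'| ≤ M ^ 2 * (|a - a'| + |b - b'| + |c - c'|) := by
  have hM : 0 ≤ M := (abs_nonneg _).trans ha
  have e : a * b * c - a' * b' * c' =
      (a - a') * (b * c) + a' * c * (b - b') + a' * b' * (c - c') := by ring
  rw [e]
  refine (abs_add_le _ _).trans ((add_le_add_left (abs_add_le _ _) _).trans ?_)
  simp only [abs_mul]
  have h1 : |b| * |c| ≤ M ^ 2 := by rw [sq]; gcongr
  have h2 : |a'| * |c| ≤ M ^ 2 := by rw [sq]; gcongr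
  have h3 : |a'| * |b'| ≤ M ^ 2 := by rw [sq]; gcongr
  nlinarith [mul_le_mul_of_nonneg_left h1 (abs_nonneg (a - a')),
    mul_le_mul_of_nonneg_left h2 (abs_nonneg (b - b')),
    mul_le_mul_of_nonneg_left h3 (abs_nonneg (c - c'))]

theorem lipschitzWith_integrand {M C : NNReal} (hM : ∀ x, |p x| ≤ M) (hC : LipschitzWith C p)
    (x y : ℝ) : LipschitzWith (M ^ 2 * (3 * C)) fun t => p t * p (x - t) * p (y - t) := by
  refine LipschitzWith.of_dist_le_mul fun s t => ?_
  rw [Real.dist_eq]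
  refine (abs_mul_mul_sub_le (hM _) (hM _) (hM _) (hM _) (hM _)).trans ?_
  have h : ∀ z, |p (z - s) - p (z - t)| ≤ C * dist s t := by
    intro z
    have := hC.dist_le_mul (z - s) (z - t)
    rwa [dist_sub_left, Real.dist_eq] at this
  have h0 := hC.dist_le_mul s t
  rw [Real.dist_eq (p s)] at h0
  push_cast
  rw [mul_assoc]
  gcongr
  linarith [h x, h y]

/-- A fixed interval containing `[0, L]` for every `r`. Starting at `-1` keeps `0` inside the
half-open interval and among the nodes of the Riemann sum, which runs down from `2`. -/
theorem limitFun_eq_intervalIntegral (hL : L ≤ 2) (hsupp : ∀ x, x ∉ Set.Icc 0 L → p x = 0)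
    (x : EuclideanSpace ℝ (Fin 2)) :
    limitFun p x = ∫ t in (-1 : ℝ)..2, p t * p (x 0 - t) * p (x 1 - t) := by
  rw [intervalIntegral.integral_eq_integral_of_support_subset, limitFun]
  intro t ht
  have h1 : t ∈ Set.Icc 0 L := by
    by_contra h
    exact left_ne_zero_of_mul (left_ne_zero_of_mul ht) (hsupp t h)
  exact ⟨by linarith [h1.1], h1.2.trans hL⟩

theorem limLength_le_two {r : ℕ} (hr : 1 ≤ r) : limLength r ≤ 2 := by
  have h : (2 : ℝ) ≤ 2 ^ r := by
    calc (2 : ℝ) = 2 ^ 1 := by norm_num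
      _ ≤ 2 ^ r := pow_le_pow_right₀ (by norm_num) hr
  have : 1 / ((2 : ℝ) ^ r - 1) ≤ 1 := by
    rw [div_le_one (by linarith)]; linarith
  rw [limLength]
  linarith

theorem limitFun_tendsto {r : ℕ} (hr : 1 ≤ r) (hp : ContDiff ℝ ∞ p)
    (hsupp : ∀ x, x ∉ Set.Icc 0 (limLength r) → p x = 0)
    (hlim : ∀ ε > 0, ∀ᶠ n : ℕ in atTop, ∀ α : ℤ,
      |p ((α : ℝ) / 2 ^ n) - 2 ^ n * (uniSymbol r n).coeff α| ≤ ε) {ε : ℝ} (hε : 0 < ε) :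
    ∀ᶠ n : ℕ in atTop, ∀ α : Lattice 2,
      |limitFun p (((2 : ℝ) ^ n)⁻¹ • toEuclid α) - (iterMask (repeatedMasks r) n).coeff α| ≤ ε := by
  have hcs : HasCompactSupport p := HasCompactSupport.intro isCompact_Icc hsupp
  obtain ⟨M, hM⟩ := hcs.exists_bound_of_continuous hp.continuous
  obtain ⟨C, hC⟩ := hp.lipschitzWith_of_hasCompactSupport hcs (by simp)
  have hM0 : 0 ≤ M := (norm_nonneg _).trans (hM 0)
  lift M to NNReal using hM0
  -- The bound `1` keeps the discrete values below `M + 1`. The `9` is interval length `3` times the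
  -- three factors of the product.
  set η : ℝ := min 1 (ε / (2 * (9 * (M + 1) ^ 2))) with hη
  have hη0 : 0 < η := by positivity
  have hinv : Tendsto (fun n : ℕ => 3 * (M ^ 2 * (3 * C) : ℝ) * (1 / 2) ^ n) atTop (𝓝 0) := by
    simpa using (tendsto_pow_atTop_nhds_zero_of_lt_one (r := (1 / 2 : ℝ)) (by norm_num)
      (by norm_num)).const_mul (3 * (M ^ 2 * (3 * C) : ℝ))
  filter_upwards [hlim η hη0, hinv.eventually_le_const (half_pos hε)] with n hn hn2 α
  have hpow : (0 : ℝ) < 2 ^ n := by positivity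
  set q : ℤ → ℝ := fun t => 2 ^ n * (uniSymbol r n).coeff t with hq
  have hqM : ∀ t, |q t| ≤ M + 1 := by
    intro t
    have h1 := hn t
    have h2 := hM ((t : ℝ) / 2 ^ n)
    rw [Real.norm_eq_abs] at h2
    have h3 := abs_sub_abs_le_abs_sub (q t) (p ((t : ℝ) / 2 ^ n))
    rw [abs_sub_comm] at h3
    have : η ≤ 1 := min_le_left _ _
    linarith
  -- the refined data as a Riemann sum
  have hsum : (iterMask (repeatedMasks r) n).coeff α = 1 / 2 ^ n *
      ∑ i ∈ Finset.range (3 * 2 ^ n),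
        q (2 * 2 ^ n - i) * q (α 0 - (2 * 2 ^ n - i)) * q (α 1 - (2 * 2 ^ n - i)) := by
    have hinj : Set.InjOn (fun i : ℕ => (2 * 2 ^ n - i : ℤ)) (Finset.range (3 * 2 ^ n)) := by
      intro i _ j _ hij
      simpa using hij
    rw [iterMask_repeatedMasks, AddMonoidAlgebra.coeff_smul, Finsupp.smul_apply,
      threeDirProd_coeff_eq_sum _ _
        (s := (Finset.range (3 * 2 ^ n)).image fun i : ℕ => (2 * 2 ^ n - i : ℤ)),
      Finset.sum_image hinj, Finset.mul_sum, smul_eq_mul, Finset.mul_sum]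
    · refine Finset.sum_congr rfl fun i _ => ?_
      -- Three factors `2 ^ n` are absorbed into `q`, against `4 ^ n` available; the discrepancy is
      -- the mesh `1 / 2 ^ n`.
      have h4 : (4 : ℝ) ^ n = 2 ^ n * 2 ^ n := by rw [← mul_pow]; norm_num
      simp only [hq]
      rw [h4]
      field_simp
    · intro t ht
      obtain ⟨h1, h2⟩ := mem_Icc_of_coeff_uniSymbol_ne_zero hr n t ht
      have h3 : t ≤ 2 * 2 ^ n := by
        have : (t : ℝ) ≤ 2 * 2 ^ n := h2.trans (by gcongr; exact limLength_le_two hr)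
        exact_mod_cast this
      rw [Finset.mem_image]
      refine ⟨(2 * 2 ^ n - t).toNat, ?_, ?_⟩
      · rw [Finset.mem_range, Int.toNat_lt' (by positivity)]
        push_cast
        have : (0 : ℤ) < 2 ^ n := by positivity
        linarith
      · rw [Int.toNat_of_nonneg (by linarith)]
        ring
  have hR := abs_integral_sub_riemannSum_le
    (lipschitzWith_integrand (M := M) (fun x => hM x) hC ((α 0 : ℝ) / 2 ^ n) ((α 1 : ℝ) / 2 ^ n))
    (h := 1 / 2 ^ n) (by positivity) 2 (3 * 2 ^ n)
  have hx : ∀ i, (((2 : ℝ) ^ n)⁻¹ • toEuclid α) i = (α i : ℝ) / 2 ^ n := by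
    intro i
    rw [div_eq_inv_mul]
    rfl
  rw [limitFun_eq_intervalIntegral (limLength_le_two hr) hsupp, hsum]
  simp only [hx]
  have hend : (2 : ℝ) - ((3 * 2 ^ n : ℕ) : ℝ) * (1 / 2 ^ n) = -1 := by
    push_cast
    field_simp
    norm_num
  rw [hend] at hR
  set I := ∫ t in (-1 : ℝ)..2, p t * p ((α 0 : ℝ) / 2 ^ n - t) * p ((α 1 : ℝ) / 2 ^ n - t)
  set S := ∑ i ∈ Finset.range (3 * 2 ^ n), p (2 - i * (1 / 2 ^ n)) *
    p ((α 0 : ℝ) / 2 ^ n - (2 - i * (1 / 2 ^ n))) * p ((α 1 : ℝ) / 2 ^ n - (2 - i * (1 / 2 ^ n)))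
    with hS
  set T := ∑ i ∈ Finset.range (3 * 2 ^ n),
    q (2 * 2 ^ n - i) * q (α 0 - (2 * 2 ^ n - i)) * q (α 1 - (2 * 2 ^ n - i)) with hT
  have hST : |S - T| ≤ (3 * 2 ^ n) * ((M + 1) ^ 2 * (η + η + η)) := by
    rw [hS, hT, ← Finset.sum_sub_distrib]
    refine (Finset.abs_sum_le_sum_abs _ _).trans ?_
    refine (Finset.sum_le_card_nsmul _ _ _ fun i _ => ?_).trans_eq
      (by rw [Finset.card_range, nsmul_eq_mul]; push_cast; rfl)
    have hpM : ∀ x, |p x| ≤ M + 1 := fun x => (hM x).trans (by simp)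
    refine (abs_mul_mul_sub_le (hpM _) (hpM _) (hqM _) (hqM _) (hpM _)).trans ?_
    have e1 : (2 : ℝ) - i * (1 / 2 ^ n) = ((2 * 2 ^ n - i : ℤ) : ℝ) / 2 ^ n := by
      push_cast; field_simp
    have e2 : ∀ z : ℤ, (z : ℝ) / 2 ^ n - ((2 * 2 ^ n - i : ℤ) : ℝ) / 2 ^ n =
        ((z - (2 * 2 ^ n - i) : ℤ) : ℝ) / 2 ^ n := by
      intro z; push_cast; field_simp
    rw [e1, e2, e2]
    gcongr <;> exact hn _
  have e : I - 1 / 2 ^ n * T = (I - 1 / 2 ^ n * S) + 1 / 2 ^ n * (S - T) := by ring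
  rw [e]
  refine (abs_add_le _ _).trans ?_
  rw [abs_mul (1 / 2 ^ n : ℝ), abs_of_pos (by positivity : (0 : ℝ) < 1 / 2 ^ n)]
  have hb1 : |I - 1 / 2 ^ n * S| ≤ ε / 2 := by
    refine hR.trans (le_trans (le_of_eq ?_) hn2)
    push_cast
    simp only [one_div_pow]
    field_simp
  have hb2 : 1 / 2 ^ n * |S - T| ≤ ε / 2 := by
    calc _ ≤ 1 / 2 ^ n * ((3 * 2 ^ n) * (((M : ℝ) + 1) ^ 2 * (η + η + η))) := by gcongr
      _ = η * (9 * ((M : ℝ) + 1) ^ 2) := by field_simp; ring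
      _ ≤ ε / (2 * (9 * (M + 1) ^ 2)) * (9 * ((M : ℝ) + 1) ^ 2) := by
        gcongr; exact min_le_right _ _
      _ = ε / 2 := by field_simp
  linarith

end LimitFunction

/-! ### Uniform limits of a scheme and their uniqueness. -/

section Limits

variable {d : ℕ} {a : ℕ → Mask d} {f : Seq d} {g : EuclideanSpace ℝ (Fin d) → ℝ}

theorem toEuclid_apply (α : Lattice d) (i : Fin d) : toEuclid α i = α i := rfl

theorem isLimit_of_forall_eventually_le
    (h : ∀ ε > 0, ∀ᶠ n : ℕ in atTop, ∀ α : Lattice d,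
      |g (((2 : ℝ) ^ n)⁻¹ • toEuclid α) - refine a f n α| ≤ ε) : IsLimit a f g := by
  refine ENNReal.tendsto_nhds_zero.2 fun ε hε => ?_
  obtain ⟨δ, hδ0, hδ⟩ := ENNReal.lt_iff_exists_nnreal_btwn.1 hε
  filter_upwards [(tendsto_add_atTop_nat 1).eventually (h δ (by exact_mod_cast hδ0))] with n hn
  refine iSup_le fun α => ?_
  refine le_trans ?_ hδ.le
  rw [enorm_le_coe, ← NNReal.coe_le_coe, coe_nnnorm, Real.norm_eq_abs]
  exact hn α

theorem IsLimit.tendsto_apply (h : IsLimit a f g) (α : ℕ → Lattice d) :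
    Tendsto (fun k : ℕ => g (((2 : ℝ) ^ (k + 1))⁻¹ • toEuclid (α k)) - refine a f (k + 1) (α k))
      atTop (𝓝 0) := by
  rw [tendsto_zero_iff_enorm_tendsto_zero]
  exact tendsto_of_tendsto_of_tendsto_of_le_of_le tendsto_const_nhds h (fun _ => zero_le)
    fun k => le_iSup (fun β => ‖g (((2 : ℝ) ^ (k + 1))⁻¹ • toEuclid β) - refine a f (k + 1) β‖ₑ) (α k)

theorem tendsto_dyadic (x : EuclideanSpace ℝ (Fin d)) :
    Tendsto (fun k : ℕ => ((2 : ℝ) ^ (k + 1))⁻¹ • toEuclid fun i => ⌊(2 : ℝ) ^ (k + 1) * x i⌋) atTop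
      (𝓝 x) := by
  have h : Tendsto (fun (k : ℕ) (i : Fin d) => (⌊(2 : ℝ) ^ (k + 1) * x i⌋ : ℝ) / 2 ^ (k + 1)) atTop
      (𝓝 x.ofLp) :=
    tendsto_pi_nhds.2 fun i => (tendsto_floor_two_pow (x i)).comp (tendsto_add_atTop_nat 1)
  have h2 := ((PiLp.continuous_toLp 2 fun _ : Fin d => ℝ).tendsto x.ofLp).comp h
  refine h2.congr fun k => ?_
  ext i
  simp [toEuclid, div_eq_inv_mul]

/-- Continuous limits are unique. -/
theorem IsLimit.unique {g' : EuclideanSpace ℝ (Fin d) → ℝ} (hg : Continuous g) (hg' : Continuous g')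
    (h : IsLimit a f g) (h' : IsLimit a f g') : g = g' := by
  ext x
  have h1 := (h.tendsto_apply fun k i => ⌊(2 : ℝ) ^ (k + 1) * x i⌋).sub
    (h'.tendsto_apply fun k i => ⌊(2 : ℝ) ^ (k + 1) * x i⌋)
  have h2 := ((hg.tendsto x).comp (tendsto_dyadic x)).sub ((hg'.tendsto x).comp (tendsto_dyadic x))
  rw [sub_zero] at h1
  refine sub_eq_zero.1 (tendsto_nhds_unique h2 (h1.congr fun k => ?_))
  simp only [Function.comp_apply]
  ring

end Limits

/-! ### From the data `δ` to arbitrary bounded data. -/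

section General

variable {d : ℕ} {a : ℕ → Mask d} {φ : EuclideanSpace ℝ (Fin d) → ℝ}

/-- The superposition of the integer translates of `φ` with coefficients `f`. -/
def translateSum (φ : EuclideanSpace ℝ (Fin d) → ℝ) (f : Seq d) (x : EuclideanSpace ℝ (Fin d)) : ℝ :=
  ∑ᶠ β : Lattice d, φ (x - toEuclid β) * f β

theorem continuous_translateSum {R : ℝ} (hφ : Continuous φ)
    (hsupp : ∀ x, φ x ≠ 0 → ∀ i, 0 ≤ x i ∧ x i ≤ R) (f : Seq d) : Continuous (translateSum φ f) := by
  refine continuous_finsum (fun β => by fun_prop) fun x₀ => ?_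
  refine ⟨Metric.ball x₀ 1, Metric.ball_mem_nhds _ one_pos, ?_⟩
  refine (Fintype.piFinset fun i => Finset.Icc ⌊x₀ i - 1 - R⌋ ⌈x₀ i + 1⌉).finite_toSet.subset ?_
  rintro β ⟨x, hx, hball⟩
  rw [Finset.mem_coe, Fintype.mem_piFinset]
  intro i
  have h1 := hsupp _ (left_ne_zero_of_mul hx) i
  have h2 : |x i - x₀ i| < 1 := by
    have := (PiLp.norm_apply_le (x - x₀) i).trans_lt (mem_ball_iff_norm.1 hball)
    simpa using this
  rw [PiLp.sub_apply, toEuclid_apply] at h1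
  have h2 := abs_lt.1 h2
  rw [Finset.mem_Icc]
  constructor
  · have : (⌊x₀ i - 1 - R⌋ : ℝ) ≤ β i := (Int.floor_le _).trans (by linarith)
    exact_mod_cast this
  · have : (β i : ℝ) ≤ ⌈x₀ i + 1⌉ := le_trans (by linarith) (Int.le_ceil _)
    exact_mod_cast this

/-- If the scheme converges for `δ` with a compactly supported limit, then it converges for all
bounded initial data. -/
theorem isLimit_translateSum {R : ℕ} (hsupp : ∀ x, φ x ≠ 0 → ∀ i, 0 ≤ x i ∧ x i ≤ R)
    (hmask : ∀ n α, (iterMask a n).coeff α ≠ 0 → ∀ i, 0 ≤ α i ∧ (α i : ℝ) ≤ R * 2 ^ n)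
    (hlim : ∀ ε > 0, ∀ᶠ n : ℕ in atTop, ∀ α : Lattice d,
      |φ (((2 : ℝ) ^ n)⁻¹ • toEuclid α) - (iterMask a n).coeff α| ≤ ε)
    {f : Seq d} (hf : supNorm f < ⊤) : IsLimit a f (translateSum φ f) := by
  obtain ⟨F, hF0, hF⟩ : ∃ F : ℝ, 0 ≤ F ∧ ∀ β, |f β| ≤ F := by
    refine ⟨(supNorm f).toReal, ENNReal.toReal_nonneg, fun β => ?_⟩
    have := ENNReal.toReal_mono hf.ne (le_iSup (fun α => ‖f α‖ₑ) β)
    simpa using this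
  refine isLimit_of_forall_eventually_le fun ε hε => ?_
  filter_upwards [hlim (ε / ((R + 1) ^ d * (F + 1))) (by positivity)] with n hn α
  have hpow : (0 : ℝ) < 2 ^ n := by positivity
  set x := ((2 : ℝ) ^ n)⁻¹ • toEuclid α with hx
  have hxi : ∀ i, x i = (α i : ℝ) / 2 ^ n := fun i => by rw [div_eq_inv_mul]; rfl
  -- This window contains every `β` that contributes to the limit or to the refined data at `x`. Its
  -- size `(R + 1) ^ d` does not depend on `x` or `n`, so the error for `δ` is multiplied by a
  -- constant.
  set W : Finset (Lattice d) := Fintype.piFinset fun i => Finset.Icc (⌊x i⌋ - R) ⌊x i⌋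
  have hW : ∀ β : Lattice d, (∀ i, 0 ≤ x i - β i ∧ x i - β i ≤ R) → β ∈ W := by
    intro β hβ
    rw [Fintype.mem_piFinset]
    intro i
    obtain ⟨h1, h2⟩ := hβ i
    rw [Finset.mem_Icc]
    refine ⟨?_, Int.le_floor.2 (by linarith)⟩
    have : ⌊x i⌋ ≤ β i + R := by
      have : (⌊x i⌋ : ℝ) ≤ ((β i + R : ℤ) : ℝ) := by
        push_cast
        linarith [Int.floor_le (x i)]
      exact_mod_cast this
    linarith
  have hcard : W.card = (R + 1) ^ d := by
    rw [Fintype.card_piFinset]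
    have : ∀ i, (Finset.Icc (⌊x i⌋ - R) ⌊x i⌋).card = R + 1 := by
      intro i
      rw [Int.card_Icc]
      omega
    simp only [this, Finset.prod_const, Finset.card_univ, Fintype.card_fin]
  have hshift : ∀ β, x - toEuclid β = ((2 : ℝ) ^ n)⁻¹ • toEuclid (α - 2 ^ n • β) := by
    intro β
    ext i
    simp [hx, toEuclid]
    field_simp
  have e1 : translateSum φ f x = ∑ β ∈ W, φ (x - toEuclid β) * f β := by
    refine finsum_eq_sum_of_support_subset _ fun β hβ => ?_
    exact hW β (hsupp _ (left_ne_zero_of_mul hβ))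
  have e2 : refine a f n α = ∑ β ∈ W, (iterMask a n).coeff (α - 2 ^ n • β) * f β := by
    rw [refine_eq_finsum]
    refine finsum_eq_sum_of_support_subset _ fun β hβ => ?_
    refine hW β fun i => ?_
    obtain ⟨h1, h2⟩ := hmask n _ (left_ne_zero_of_mul hβ) i
    have h1' : (0 : ℝ) ≤ ((α - 2 ^ n • β) i : ℤ) := by exact_mod_cast h1
    have e : (((α - 2 ^ n • β) i : ℤ) : ℝ) = α i - 2 ^ n * β i := by simp
    rw [e] at h1' h2
    rw [hxi]
    constructor
    · rw [sub_nonneg, le_div_iff₀ hpow]; linarith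
    · rw [sub_le_iff_le_add, div_le_iff₀ hpow]; linarith
  rw [e1, e2, ← Finset.sum_sub_distrib]
  refine (Finset.abs_sum_le_sum_abs _ _).trans ?_
  calc _ ≤ W.card • (ε / ((R + 1) ^ d * (F + 1)) * (F + 1)) := by
        refine Finset.sum_le_card_nsmul _ _ _ fun β _ => ?_
        rw [← sub_mul, abs_mul, hshift]
        have := hF β
        gcongr
        · exact hn _
        · linarith
    _ = ε := by
        rw [hcard, nsmul_eq_mul]
        push_cast
        field_simp

end General

/-! ### The support as a dilated zonotope. -/

section Support

/-- The three directions in the plane. -/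
def directions : Fin 3 → EuclideanSpace ℝ (Fin 2) := ![!₂[1, 0], !₂[0, 1], !₂[1, 1]]

theorem coeff_halfMask (t : ℤ) : halfMask.coeff t = if t = 0 ∨ t = 1 then 1 / 2 else 0 := by
  rw [halfMask, AddMonoidAlgebra.one_def]
  simp only [AddMonoidAlgebra.coeff_smul, AddMonoidAlgebra.coeff_add, AddMonoidAlgebra.coeff_single,
    Finsupp.smul_apply, Finsupp.add_apply, Finsupp.single_apply, smul_eq_mul]
  by_cases h0 : t = 0
  · subst h0; norm_num
  · by_cases h1 : t = 1
    · subst h1; norm_num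
    · simp [h0, h1, Ne.symm h0, Ne.symm h1]

theorem coeff_threeDirMask_one_ne_zero_iff (α : Lattice 2) :
    (threeDirMask 1).coeff α ≠ 0 ↔ ((α 0 = 0 ∨ α 0 = 1) ∧ (α 1 = 0 ∨ α 1 = 1)) ∨
      ((α 0 - 1 = 0 ∨ α 0 - 1 = 1) ∧ (α 1 - 1 = 0 ∨ α 1 - 1 = 1)) := by
  rw [threeDirMask_eq, pow_one, AddMonoidAlgebra.coeff_smul, Finsupp.smul_apply,
    threeDirProd_coeff_eq_sum _ _ (s := {0, 1}), Finset.sum_pair zero_ne_one]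
  · simp only [coeff_halfMask, sub_zero]
    split_ifs <;> simp_all
  · intro t ht
    rw [coeff_halfMask] at ht
    simpa [or_iff_not_imp_left] using ht

/-- The coefficients of `s` are sums of nonnegative terms, so nothing cancels and the support is the
full Minkowski sum. Its convex hull is then the parallelepiped of the three directions. -/
theorem toEuclid_image_support :
    toEuclid '' {α : Lattice 2 | (threeDirMask 1).coeff α ≠ 0} = ∑ i, {0, directions i} := by
  simp only [coeff_threeDirMask_one_ne_zero_iff, Fin.sum_univ_three]
  ext x
  simp only [Set.mem_image, Set.mem_ofPred_eq, Set.mem_add, Set.mem_insert_iff,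
    Set.mem_singleton_iff]
  constructor
  · rintro ⟨α, hα, rfl⟩
    have key : ∀ b : EuclideanSpace ℝ (Fin 2), (b = 0 ∨ b = directions 2) →
        (toEuclid α 0 - b 0 = 0 ∨ toEuclid α 0 - b 0 = 1) →
        (toEuclid α 1 - b 1 = 0 ∨ toEuclid α 1 - b 1 = 1) →
        ∃ u, (∃ y, (y = 0 ∨ y = directions 0) ∧ ∃ z, (z = 0 ∨ z = directions 1) ∧ y + z = u) ∧
          ∃ w, (w = 0 ∨ w = directions 2) ∧ u + w = toEuclid α := by
      intro b hb h0 h1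
      refine ⟨_, ⟨if toEuclid α 0 - b 0 = 0 then 0 else directions 0, by split_ifs <;> simp,
        if toEuclid α 1 - b 1 = 0 then 0 else directions 1, by split_ifs <;> simp, rfl⟩, b, hb, ?_⟩
      ext i
      fin_cases i
      · rcases h0 with h0 | h0 <;> rcases h1 with h1 | h1 <;>
          simp [h0, h1, directions] <;> linarith
      · rcases h0 with h0 | h0 <;> rcases h1 with h1 | h1 <;>
          simp [h0, h1, directions] <;> linarith
    rcases hα with ⟨h0, h1⟩ | ⟨h0, h1⟩
    · refine key 0 (Or.inl rfl) ?_ ?_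
      · simpa [toEuclid_apply] using h0
      · simpa [toEuclid_apply] using h1
    · refine key (directions 2) (Or.inr rfl) ?_ ?_
      · have : ((α 0 : ℝ) - 1 = 0 ∨ (α 0 : ℝ) - 1 = 1) := by exact_mod_cast h0
        simpa [toEuclid_apply, directions] using this
      · have : ((α 1 : ℝ) - 1 = 0 ∨ (α 1 : ℝ) - 1 = 1) := by exact_mod_cast h1
        simpa [toEuclid_apply, directions] using this
  · have key : ∀ m n k : ℤ, (m = 0 ∨ m = 1) → (n = 0 ∨ n = 1) → (k = 0 ∨ k = 1) →
        ∃ α : Lattice 2, (((α 0 = 0 ∨ α 0 = 1) ∧ (α 1 = 0 ∨ α 1 = 1)) ∨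
          ((α 0 - 1 = 0 ∨ α 0 - 1 = 1) ∧ (α 1 - 1 = 0 ∨ α 1 - 1 = 1))) ∧
          toEuclid α = (m : ℝ) • directions 0 + (n : ℝ) • directions 1 + (k : ℝ) • directions 2 := by
      intro m n k hm hn hk
      refine ⟨![m + k, n + k], ?_, ?_⟩
      · rcases hk with rfl | rfl
        · left; simpa using ⟨hm, hn⟩
        · right; simpa using ⟨hm, hn⟩
      · ext i
        fin_cases i <;> simp [toEuclid, directions]
    have int_smul : ∀ (v y : EuclideanSpace ℝ (Fin 2)), (y = 0 ∨ y = v) →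
        ∃ m : ℤ, (m = 0 ∨ m = 1) ∧ y = (m : ℝ) • v := by
      rintro v y (rfl | rfl)
      · exact ⟨0, by simp⟩
      · exact ⟨1, by simp⟩
    rintro ⟨_, ⟨y, hy, z, hz, rfl⟩, w, hw, rfl⟩
    obtain ⟨m, hm, rfl⟩ := int_smul _ _ hy
    obtain ⟨n, hn, rfl⟩ := int_smul _ _ hz
    obtain ⟨k, hk, rfl⟩ := int_smul _ _ hw
    exact key m n k hm hn hk

theorem Esupp_threeDirMask_one : Esupp (threeDirMask 1) = parallelepiped directions := by
  rw [Esupp, toEuclid_image_support, ← parallelepiped_eq_convexHull]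
  refine IsClosed.closure_eq (IsCompact.isClosed ?_)
  exact isCompact_Icc.image (by fun_prop)

/-- The linear parametrisation `(t, a, b) ↦ (a + t, b + t)`. -/
def hexMap (q : ℝ × ℝ × ℝ) : EuclideanSpace ℝ (Fin 2) := !₂[q.2.1 + q.1, q.2.2 + q.1]

theorem continuous_hexMap : Continuous hexMap := by
  refine (PiLp.continuous_toLp 2 fun _ : Fin 2 => ℝ).comp (continuous_pi fun i => ?_)
  fin_cases i
  · exact (continuous_snd.fst).add continuous_fst
  · exact (continuous_snd.snd).add continuous_fst

theorem hexMap_image_cube {L : ℝ} (hL : 0 < L) :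
    hexMap '' (Set.Icc 0 L ×ˢ Set.Icc 0 L ×ˢ Set.Icc 0 L) = L • parallelepiped directions := by
  ext x
  rw [Set.mem_smul_set]
  constructor
  · rintro ⟨⟨t, a, b⟩, ⟨⟨ht0, htL⟩, ⟨ha0, haL⟩, ⟨hb0, hbL⟩⟩, rfl⟩
    refine ⟨L⁻¹ • hexMap (t, a, b), ?_, smul_inv_smul₀ hL.ne' _⟩
    rw [mem_parallelepiped_iff]
    refine ⟨![L⁻¹ * a, L⁻¹ * b, L⁻¹ * t], ⟨fun i => ?_, fun i => ?_⟩, ?_⟩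
    · fin_cases i <;> exact mul_nonneg (by positivity) (by assumption)
    · fin_cases i <;> exact (inv_mul_le_one₀ hL).2 (by assumption)
    · ext i
      rw [Fin.sum_univ_three]
      fin_cases i <;> simp [hexMap, directions, mul_add]
  · rintro ⟨y, hy, rfl⟩
    obtain ⟨s, ⟨hs0, hs1⟩, rfl⟩ := (mem_parallelepiped_iff _ _).1 hy
    have hmem : ∀ i, L * s i ∈ Set.Icc 0 L := fun i =>
      ⟨mul_nonneg hL.le (hs0 i), mul_le_of_le_one_right hL.le (hs1 i)⟩
    refine ⟨(L * s 2, L * s 0, L * s 1), ⟨hmem 2, hmem 0, hmem 1⟩, ?_⟩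
    ext i
    rw [Fin.sum_univ_three]
    fin_cases i <;> simp [hexMap, directions]

/-- Closure commutes with a continuous image when the closure of the source is compact, so the image
of the open cube closes up to that of the closed cube. -/
theorem tsupport_limitFun {p : ℝ → ℝ} {L : ℝ} (hL : 0 < L)
    (h : ∀ x, limitFun p x ≠ 0 ↔
      ∃ t ∈ Set.Ioo 0 L, x 0 - t ∈ Set.Ioo 0 L ∧ x 1 - t ∈ Set.Ioo 0 L) :
    tsupport (limitFun p) = L • Esupp (threeDirMask 1) := by
  have hs : Function.support (limitFun p) =
      hexMap '' (Set.Ioo 0 L ×ˢ Set.Ioo 0 L ×ˢ Set.Ioo 0 L) := by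
    ext x
    rw [Function.mem_support, h]
    constructor
    · rintro ⟨t, ht, h0, h1⟩
      refine ⟨(t, x 0 - t, x 1 - t), ⟨ht, h0, h1⟩, ?_⟩
      ext i
      fin_cases i <;> simp [hexMap]
    · rintro ⟨⟨t, a, b⟩, ⟨ht, ha, hb⟩, rfl⟩
      exact ⟨t, ht, by simpa [hexMap] using ha, by simpa [hexMap] using hb⟩
  have hcl : closure (Set.Ioo 0 L ×ˢ Set.Ioo 0 L ×ˢ Set.Ioo 0 L) =
      Set.Icc 0 L ×ˢ Set.Icc 0 L ×ˢ Set.Icc 0 L := by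
    rw [closure_prod_eq, closure_prod_eq, closure_Ioo hL.ne]
  rw [tsupport, hs, ← image_closure_of_isCompact _ continuous_hexMap.continuousOn, hcl,
    hexMap_image_cube hL, Esupp_threeDirMask_one]
  rw [hcl]
  exact isCompact_Icc.prod (isCompact_Icc.prod isCompact_Icc)

end Support

/-! ### The initial data `δ` and the conclusion. -/

theorem delta_ne_zero (d : ℕ) : delta d ≠ 0 := by
  intro h
  have := congrFun h 0
  simp [delta] at this

theorem supNorm_delta_lt_top (d : ℕ) : supNorm (delta d) < ⊤ := by
  refine lt_of_le_of_lt (iSup_le fun α => ?_) ENNReal.one_lt_top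
  rw [delta, Pi.single_apply]
  split_ifs <;> simp

end

end Subdivision

open Subdivision

theorem proposition5p5 (r : ℕ) (hr : 1 ≤ r) :
    Subdivision.Converges (Subdivision.repeatedMasks r) 0 ∧
    ∃ φ : EuclideanSpace ℝ (Fin 2) → ℝ,
      ContDiff ℝ ∞ φ ∧
      Subdivision.IsLimit (Subdivision.repeatedMasks r) (Subdivision.delta 2) φ ∧
      (∀ ψ : EuclideanSpace ℝ (Fin 2) → ℝ, Continuous ψ →
        Subdivision.IsLimit (Subdivision.repeatedMasks r) (Subdivision.delta 2) ψ → ψ = φ) ∧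
      tsupport φ =
        (1 + 1 / ((2 : ℝ) ^ r - 1)) • Subdivision.Esupp (Subdivision.threeDirMask 1) := by
  obtain ⟨p, hp, hnn, hsupp, hpos, hlim⟩ := exists_density hr
  have hL := limLength_pos hr
  have hφ := contDiff_limitFun hp hsupp
  have hne := limitFun_ne_zero_iff hp.continuous hnn hsupp hpos
  have hbd : 2 * limLength r ≤ (4 : ℕ) := by
    have := limLength_le_two hr
    push_cast
    linarith
  have htend := fun (ε : ℝ) (hε : ε > 0) => limitFun_tendsto hr hp hsupp hlim hε
  have hδ : IsLimit (repeatedMasks r) (delta 2) (limitFun p) :=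
    isLimit_of_forall_eventually_le fun ε hε => by simpa only [refine_delta] using htend ε hε
  have hsuppφ : ∀ x, limitFun p x ≠ 0 → ∀ i, 0 ≤ x i ∧ x i ≤ (4 : ℕ) := by
    intro x hx
    obtain ⟨t, ht, h0, h1⟩ := (hne x).1 hx
    rw [Fin.forall_fin_two]
    exact ⟨⟨by linarith [ht.1, h0.1], by linarith [ht.2, h0.2]⟩,
      ⟨by linarith [ht.1, h1.1], by linarith [ht.2, h1.2]⟩⟩
  have hφ0 : limitFun p ≠ 0 := by
    intro h
    have hmid : limLength r / 2 ∈ Set.Ioo 0 (limLength r) := ⟨by linarith, by linarith⟩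
    -- The point `(L, L)` is the image of the centre of the cube, where all three arguments of `p`
    -- equal `L / 2`.
    refine (hne !₂[limLength r, limLength r]).2 ⟨_, hmid, ?_, ?_⟩ (congrFun h _)
    · simpa [sub_half] using hmid
    · simpa [sub_half] using hmid
  refine ⟨⟨fun f hf => ⟨translateSum (limitFun p) f, ?_, ?_⟩, delta 2, delta_ne_zero 2,
    supNorm_delta_lt_top 2, limitFun p, hφ0, hφ.of_le (by simp), hδ⟩,
    limitFun p, hφ, hδ, fun ψ hψ h => h.unique hψ hφ.continuous hδ, tsupport_limitFun hL hne⟩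
  · exact contDiff_zero.2 (continuous_translateSum hφ.continuous hsuppφ f)
  · refine isLimit_translateSum hsuppφ (fun n α h i => ?_) htend hf
    obtain ⟨h1, h2⟩ := coeff_iterMask_repeatedMasks_ne_zero hr h i
    exact ⟨h1, h2.trans (by gcongr)⟩
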